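/- Let $M>1$ and $\eta>0$ be real numbers, let $k\ge 1$ and $m\ge 0$ be integers, and let $\rho\in[1,M]$. **The functions $\gamma_{m,M,k}$.** Put $\exp_k(z)=\sum_{j=0}^{k-1} z^j/j!$ and $A_M(z)=\int_{1/M}^1\frac{1-e^{-zt}}{t}\,dt$, and define recursively $\gamma_{0,M,k}(u)=u$ and $\gamma_{m+1,M,k}(u)=u\,\exp_k\!\big(A_M(\gamma_{m,M,k}(u))\big)$. **The limiting Poisson hypergraph.** Let $\mu_{k-1}$ be the measure on the finite subsets of $[1,M]$ of cardinality between $1$ and $k-1$ which, on the subsets of cardinality $j$ (identified with $\{1\le\rho_1<\dots<\rho_j\le M\}\subset\mathbb R^j$), has density $1/(\rho_1\cdots\rho_j)$ with respect to Lebesgue measure. For $\tau\in[1,M]$ let $\nu_\tau$ be the law of the random finite set of hyperedges $\{\tau\}\cup S$, where $S$ runs through the points of a Poisson process with intensity measure $\frac{\eta}{\tau}\,\mu_{k-1}$. Let $\mathcal H_{0,\rho}$ be the hypergraph without hyperedges whose only vertex is $\rho$. Given $\mathcal H_{m,\rho}$, let $T_{m,\rho}$ be the set of its vertices which are not vertices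 of $\mathcal H_{m-1,\rho}$ (with $T_{0,\rho}=\{\rho\}$), choose, independently for the different $\tau\in T_{m,\rho}$ and independently of $\mathcal H_{m,\rho}$ given $T_{m,\rho}$, sets of hyperedges with laws $\nu_\tau$, and let $\mathcal H_{m+1,\rho}$ be the union of $\mathcal H_{m,\rho}$ with all of them. Finally let $\tilde U_{m,\rho}$ be the random set of marked vertices obtained by marking each vertex $\tau$ of $\mathcal H_{m,\rho}$ (including the root $\rho$) independently with probability $1-e^{-\eta/\tau}$. **The witness event.** A finite hypergraph $G$ rooted at a vertex $p$ is tree-like if its vertices carry a tree structure rooted at $p$ such that, for a suitable partition of the set of children of each vertex $q$ into nonempty blocks, the hyperedges of $G$ are exactly the sets $B\cup\{q\}$ with $B$ a block of children of $q$; these are called the child hyperedges of $q$. For a tree-like $G$ with a set $U$ of marked vertices define $\chi(q)$ recursively, from the leaves up: $\chi(q)$ holds if and only if $q\in U$ or there is a child hyperedge $S$ of $q$ such that $\chi(q')$ holds for every $q'\in S\setminus\{q\}$. Let $\chi(G,U)$ be the statement that $G$ is tree-like and $\chi(p)$ holds for its root $p$. The witness probability is $$\theta_{m,k}^{M,\eta}(\rho)=\mathbb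 P\big(\chi(\mathcal H_{m,\rho},\tilde U_{m,\rho})\big).$$ **Lemma.** $\chi(\mathcal H_{m,\rho},\tilde U_{m,\rho})$ is an event (it is measurable up to a null set), and $$\theta_{m,k}^{M,\eta}(\rho)=1-e^{-\gamma_{m,M,k}(\eta)/\rho}.$$ -/

import Mathlib

open MeasureTheory ProbabilityTheory

namespace PoissonHypergraph

/-! ### The functions `exp_k`, `A_M` and `γ_{m,M,k}` -/

/-- The truncated exponential `exp_k z = ∑_{j=0}^{k-1} z^j / j!`. -/
noncomputable def expTrunc (k : ℕ) (z : ℝ) : ℝ :=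
  ∑ j ∈ Finset.range k, z ^ j / (Nat.factorial j : ℝ)

/-- `A_M z = ∫_{1/M}^1 (1 - e^{-zt}) / t dt`. -/
noncomputable def A (M z : ℝ) : ℝ :=
  ∫ t in (1 / M)..1, (1 - Real.exp (-(z * t))) / t

/-- `γ_{0,M,k}(u) = u` and `γ_{m+1,M,k}(u) = u * exp_k (A_M (γ_{m,M,k}(u)))`. -/
noncomputable def gamma (M : ℝ) (k : ℕ) : ℕ → ℝ → ℝ
  | 0, u => u
  | m + 1, u => u * expTrunc k (A M (gamma M k m u))

/-! ### Rooted hypergraphs, tree-likeness and the event `χ`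

A finite hypergraph on `V` is the finite set `G : Finset (Finset V)` of its hyperedges. -/

/-- The support of a hypergraph rooted at `p`. The root always counts as a vertex, also when there
are no hyperedges at all. -/
def vertices {V : Type*} [DecidableEq V] (G : Finset (Finset V)) (p : V) : Finset V :=
  insert p (G.biUnion id)

/-- The children of `q` when the rooted tree structure on the vertices is given by the parent map
`par` (whose value at the root `p` is irrelevant). -/
def children {V : Type*} [DecidableEq V] (G : Finset (Finset V)) (p : V) (par : V → V) (q : V) :
    Finset V :=
  (vertices G p).filter (fun v => v ≠ p ∧ par v = q)

/-- The parent map `par` makes the vertices of `G` into a tree rooted at `p` which exhibits `G` as a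
tree-like hypergraph: the set of children of each vertex `q` can be partitioned into nonempty
blocks such that the hyperedges are exactly the sets `B ∪ {q}`, with `B` a block of children
of `q`. -/
structure IsTreeStructure {V : Type*} [DecidableEq V] (G : Finset (Finset V)) (p : V)
    (par : V → V) : Prop where
  par_mem : ∀ v ∈ vertices G p, v ≠ p → par v ∈ vertices G p
  reaches_root : ∀ v ∈ vertices G p, ∃ n : ℕ, par^[n] v = p
  decomposition : ∃ P : (q : V) → Finpartition (children G p par q),
    ∀ S : Finset V, S ∈ G ↔ ∃ q ∈ vertices G p, ∃ B ∈ (P q).parts, S = insert q B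

/-- The event `χ(q)` for a hypergraph `G` with tree structure `par` and set of marks `U`
(a mark at `q` plays the role of the singleton hyperedge `{q}`): `χ(q)` holds if `q` is marked, or
if there is a child hyperedge `S` of `q`, i.e. a hyperedge consisting of `q` and of children of
`q`, such that `χ(v)` holds for each `v ∈ S` other than `q`. On a finite tree this inductive
predicate is the recursion along the height of `q`; at a leaf only the first clause can apply. -/
inductive ChiAt {V : Type*} [DecidableEq V] (G : Finset (Finset V)) (U : Finset V) (p : V)
    (par : V → V) : V → Prop
  | mark {q : V} (hq : q ∈ U) : ChiAt G U p par q
  | edge {q : V} {S : Finset V} (hS : S ∈ G) (hqS : q ∈ S)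
      (hchild : ∀ v ∈ S, v ≠ q → v ∈ children G p par q)
      (hrec : ∀ v ∈ S, v ≠ q → ChiAt G U p par v) : ChiAt G U p par q

/-- The event `χ(G, U)` for a marked hypergraph rooted at `p`: the hypergraph is tree-like
(its tree structure is then unique on the vertices) and `χ(p)` holds. -/
def Chi {V : Type*} [DecidableEq V] (G : Finset (Finset V)) (U : Finset V) (p : V) : Prop :=
  ∃ par : V → V, IsTreeStructure G p par ∧ ChiAt G U p par p

/-! ### Poisson processes with finite intensity measure -/

/-- The probability measure proportional to a finite nonzero measure `μ` (and a point mass when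
`μ` is zero or infinite, which makes it a probability measure in all cases). -/
noncomputable def normalized {X : Type*} [MeasurableSpace X] [Inhabited X] (μ : Measure X) :
    Measure X :=
  open Classical in
  if μ Set.univ = 0 ∨ μ Set.univ = ⊤ then Measure.dirac default else (μ Set.univ)⁻¹ • μ

instance {X : Type*} [MeasurableSpace X] [Inhabited X] (μ : Measure X) :
    IsProbabilityMeasure (normalized μ) := by
  unfold normalized
  split_ifs with h
  · infer_instance
  · push Not at h
    exact ⟨by simp [ENNReal.inv_mul_cancel h.1 h.2]⟩

/-- The Poisson process with finite intensity measure `μ`: the pair `(N, x)` encodes the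
configuration of points `{x i | i < N}`, where the number `N` of points is Poisson distributed
with mean `μ(X)`, and the `x i` are independent with law `μ / μ(X)` and independent of `N`. -/
noncomputable def poissonProcess {X : Type*} [MeasurableSpace X] [Inhabited X] (μ : Measure X) :
    Measure (ℕ × (ℕ → X)) :=
  (poissonMeasure (μ Set.univ).toNNReal).prod (Measure.infinitePi fun _ => normalized μ)

instance {X : Type*} [MeasurableSpace X] [Inhabited X] (μ : Measure X) :
    IsProbabilityMeasure (poissonProcess μ) := by
  unfold poissonProcess; infer_instance

/-- The uniform distribution on `[0,1]`. -/
noncomputable def uniform01 : Measure ℝ := volume.restrict (Set.Icc 0 1)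

instance : IsProbabilityMeasure uniform01 := ⟨by simp [uniform01]⟩

/-! ### The measure `μ_n` on finite subsets of `[1,M]` -/

/-- The sector `W_j = {1 ≤ ρ_1 < ⋯ < ρ_j ≤ M}` of `ℝ^j`. -/
def sector (M : ℝ) (j : ℕ) : Set (Fin j → ℝ) :=
  {r | StrictMono r ∧ ∀ i, r i ∈ Set.Icc 1 M}

/-- Finite tuples of reals; a finite subset of `[1,M]` is identified with the increasing tuple of
its elements. -/
abbrev Tuple : Type := (j : ℕ) × (Fin j → ℝ)

/-- The finite set of the entries of a tuple. -/
noncomputable def Tuple.toFinset (S : Tuple) : Finset ℝ := Finset.univ.image S.2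

/-- The measure `μ_n` on the subsets of `[1,M]` of cardinality between `1` and `n`: on the subsets
of cardinality `j`, identified with `W_j`, it has density `1 / (ρ_1 ⋯ ρ_j)` with respect to
Lebesgue measure. -/
noncomputable def mu (M : ℝ) (n : ℕ) : Measure Tuple :=
  ∑ j ∈ Finset.Icc 1 n,
    ((volume.restrict (sector M j)).withDensity
      (fun r => ENNReal.ofReal (∏ i, (r i)⁻¹))).map (Sigma.mk j)

/-! ### The random marked hypergraph `(H_{m,ρ}, U_{m,ρ})`

The vertices are generated generation by generation, starting from the root. A vertex with label
`τ ∈ [1,M]` gets the hyperedges `{τ} ∪ S`, with `S` running through the points of a Poisson process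
with intensity `(η / τ) μ_{k-1}`, so that the hyperedges have cardinality between `2` and `k`, and
it is marked with probability `1 - e^{-η/τ}`; all these choices are independent.

To have this for all labels `τ` on one probability space, each vertex carries a Poisson process on
`[0,1] × {finite subsets of [1,M]}` with intensity `η dt μ_{k-1}(dS)`: its points `(t, S)` with
`t ≤ 1 / τ` give a Poisson process of sets `S` with intensity `(η / τ) μ_{k-1}`. -/

/-- The randomness attached to one vertex: a configuration of points `(t, S)`, and a number in
`[0,1]` that decides whether the vertex is marked. -/
abbrev Seed : Type := (ℕ × (ℕ → ℝ × Tuple)) × ℝ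

/-- The law of the randomness attached to one vertex. -/
noncomputable def seedLaw (M η : ℝ) (k : ℕ) : Measure Seed :=
  (poissonProcess (ENNReal.ofReal η • (uniform01.prod (mu M (k - 1))))).prod uniform01

instance (M η : ℝ) (k : ℕ) : IsProbabilityMeasure (seedLaw M η k) := by
  unfold seedLaw; infer_instance

/-- Addresses of vertices in the genealogical tree: the root is `[]`, and `(i, l) :: a` is the
`l`-th new vertex of the `i`-th hyperedge of the vertex with address `a`. -/
abbrev Addr : Type := List (ℕ × ℕ)

/-- The sample space. -/
abbrev Sample : Type := Addr → Seed

/-- The probability measure: independent seeds at the different addresses. -/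
noncomputable def prob (M η : ℝ) (k : ℕ) : Measure Sample :=
  Measure.infinitePi fun _ => seedLaw M η k

instance (M η : ℝ) (k : ℕ) : IsProbabilityMeasure (prob M η k) := by
  unfold prob; infer_instance

/-- The `i`-th tuple at the vertex with address `a`. -/
def tuple (ω : Sample) (a : Addr) (i : ℕ) : Tuple := ((ω a).1.2 i).2

/-- The label, a real number, of the vertex with a given address, when the root has label `ρ`. -/
noncomputable def label (ρ : ℝ) (ω : Sample) : Addr → ℝ
  | [] => ρ
  | (i, l) :: a => if h : l < (tuple ω a i).1 then (tuple ω a i).2 ⟨l, h⟩ else 0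

/-- The indices of the hyperedges of the vertex with address `a`: those of the points `(t, S)` of
its Poisson process with `t ≤ 1 / τ`, where `τ` is its label. -/
noncomputable def edgeIndices (ρ : ℝ) (ω : Sample) (a : Addr) : Finset ℕ :=
  (Finset.range (ω a).1.1).filter (fun i => ((ω a).1.2 i).1 ≤ 1 / label ρ ω a)

/-- The hyperedges `{τ} ∪ S` of the vertex with address `a` and label `τ`. -/
noncomputable def newEdges (ρ : ℝ) (ω : Sample) (a : Addr) : Finset (Finset ℝ) :=
  (edgeIndices ρ ω a).image (fun i => insert (label ρ ω a) (tuple ω a i).toFinset)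

/-- The addresses of the vertices of generation `m`, i.e. of the vertices at distance `m` from the
root; their labels form the set `T_{m,ρ}`. -/
noncomputable def generation (ρ : ℝ) (ω : Sample) : ℕ → Finset Addr
  | 0 => {[]}
  | m + 1 => (generation ρ ω m).biUnion fun a =>
      (edgeIndices ρ ω a).biUnion fun i =>
        (Finset.range (tuple ω a i).1).image fun l => (i, l) :: a

/-- The random hypergraph `H_{m,ρ}`: `H_{0,ρ}` has no hyperedges, and `H_{m+1,ρ}` is the union of
`H_{m,ρ}` with the hyperedges of the vertices of generation `m`. -/
noncomputable def hypergraph (ρ : ℝ) (ω : Sample) : ℕ → Finset (Finset ℝ)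
  | 0 => ∅
  | m + 1 => hypergraph ρ ω m ∪ (generation ρ ω m).biUnion (newEdges ρ ω)

/-- The random set `U_{m,ρ}` of marks: each vertex of `H_{m,ρ}`, with label `τ`, is marked with
probability `1 - e^{-η/τ}`. -/
noncomputable def marks (η ρ : ℝ) (ω : Sample) (m : ℕ) : Finset ℝ :=
  (((Finset.range (m + 1)).biUnion (generation ρ ω)).filter
    (fun a => (ω a).2 ≤ 1 - Real.exp (-(η / label ρ ω a)))).image (label ρ ω)

/-- The event `χ'_{m,ρ} = χ(H_{m,ρ}, U_{m,ρ})`. -/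
def chiEvent (η ρ : ℝ) (m : ℕ) : Set Sample :=
  {ω | Chi (hypergraph ρ ω m) (marks η ρ ω m) ρ}

/-- The witness probability `θ_{m,k}^{M,η}(ρ)`. -/
noncomputable def theta (M η : ℝ) (k m : ℕ) (ρ : ℝ) : ℝ :=
  (prob M η k).real (chiEvent η ρ m)

end PoissonHypergraph

/-!
# Witness probabilities of the Poisson hypergraph

The random hypergraph is the image of a branching process under the labels of its vertices, and
`Witness` is the event `χ` computed along the genealogical tree of that process. Two independent
facts give the formula.

*Almost surely the labels lose no information.* Tuples with different indices are independent with
diffuse laws, and the entries of one tuple are distinct, so that almost surely different vertices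
of the branching process have different labels (`ae_isGeneric`). Then the hypergraph is tree-like
for the genealogical tree (`isTreeStructure_parent`), no other tree structure is possible on its
vertices (`IsTreeStructure.par_label`), and `χ` agrees with `Witness` (`chi_iff_witness`). The
event `χ` therefore differs from a measurable set by a null set.

*The branching property gives a recursion.* Let `q n τ` be the probability that a root with label
`τ` has a witness within `n` generations. The seed of the root is independent of the subtrees,
which are independent copies of the whole sample (`map_prob_root_subtree`). A root without a
witness is unmarked, and none of the points of its Poisson process spans a hyperedge whose other
vertices all have a witness (`prob_not_witness_succ`). By the formula for void probabilities
(`lintegral_poissonProcess_prod`) this gives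
`1 - q (n + 1) τ = exp (-η / τ) * exp (-(η / τ) * ∫ ∏_{x ∈ S} q n x dμ_{k-1}(S))`.
An integral over increasing `j`-tuples of a product is `1 / j!` times a `j`-th power
(`factorial_mul_lintegral_sector`), so the integral is `exp_k (a) - 1` with
`a = ∫_1^M q n x / x dx`. If `q n x = 1 - exp (-γ / x)`, the substitution `t = 1 / x` shows that
`a = A_M γ` (`lintegral_eq_A`), and the formula for `n + 1` follows.
-/

namespace PoissonHypergraph

/-! ### Addresses, witnesses and generic samples -/

/-- The vertex with address `a` is marked. -/
def IsMarked (η ρ : ℝ) (ω : Sample) (a : Addr) : Prop :=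
  (ω a).2 ≤ 1 - Real.exp (-(η / label ρ ω a))

/-- The event `χ` at the vertex with address `a`, evaluated along the genealogical tree when `n`
more generations are taken into account. -/
def Witness (η ρ : ℝ) (ω : Sample) : ℕ → Addr → Prop
  | 0, a => IsMarked η ρ ω a
  | n + 1, a => IsMarked η ρ ω a ∨
      ∃ i ∈ edgeIndices ρ ω a, ∀ l < (tuple ω a i).1, Witness η ρ ω n ((i, l) :: a)

/-- The address `a` belongs to an entry of one of the finitely many tuples carried by the parent
address. Whether the parent is itself present is not part of the condition. -/
def IsValid (ω : Sample) : Addr → Prop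
  | [] => True
  | (i, l) :: a => i < (ω a).1.1 ∧ l < (tuple ω a i).1

/-- The almost sure properties of a sample which make the random hypergraph tree-like: tuples are
nonempty, and distinct addresses carry distinct labels. -/
structure IsGeneric (ρ : ℝ) (ω : Sample) : Prop where
  tuple_pos : ∀ a i, i < (ω a).1.1 → 0 < (tuple ω a i).1
  label_inj : ∀ a b, IsValid ω a → IsValid ω b → label ρ ω a = label ρ ω b → a = b

section Generation

variable {η ρ : ℝ} {ω : Sample} {m n i l : ℕ} {a b : Addr}

@[simp]
lemma mem_generation_zero : a ∈ generation ρ ω 0 ↔ a = [] := by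
  simp [generation]

lemma cons_mem_generation_succ :
    (i, l) :: a ∈ generation ρ ω (m + 1) ↔
      a ∈ generation ρ ω m ∧ i ∈ edgeIndices ρ ω a ∧ l < (tuple ω a i).1 := by
  simp only [generation, Finset.mem_biUnion, Finset.mem_image, Finset.mem_range]
  constructor
  · rintro ⟨b, hb, i', hi', l', hl', h⟩
    simp only [List.cons.injEq, Prod.mk.injEq] at h
    obtain ⟨⟨rfl, rfl⟩, rfl⟩ := h
    exact ⟨hb, hi', hl'⟩
  · rintro ⟨ha, hi, hl⟩
    exact ⟨a, ha, i, hi, l, hl, rfl⟩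

lemma length_of_mem_generation (h : a ∈ generation ρ ω m) : a.length = m := by
  induction m generalizing a with
  | zero => simp_all
  | succ m ih =>
    simp only [generation, Finset.mem_biUnion, Finset.mem_image] at h
    obtain ⟨b, hb, _, _, _, _, rfl⟩ := h
    simp [ih hb]

lemma lt_of_mem_edgeIndices (h : i ∈ edgeIndices ρ ω a) : i < (ω a).1.1 := by
  simp only [edgeIndices, Finset.mem_filter, Finset.mem_range] at h
  exact h.1

lemma isValid_of_mem_generation (h : a ∈ generation ρ ω m) : IsValid ω a := by
  cases m with
  | zero => simp_all [IsValid]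
  | succ m =>
    match a with
    | [] => trivial
    | (i, l) :: b =>
      rw [cons_mem_generation_succ] at h
      exact ⟨lt_of_mem_edgeIndices h.2.1, h.2.2⟩

lemma IsGeneric.eq_of_label_eq (hω : IsGeneric ρ ω) (ha : a ∈ generation ρ ω m)
    (hb : b ∈ generation ρ ω n) (h : label ρ ω a = label ρ ω b) : a = b :=
  hω.label_inj a b (isValid_of_mem_generation ha) (isValid_of_mem_generation hb) h

lemma mem_toFinset_tuple {v : ℝ} :
    v ∈ (tuple ω a i).toFinset ↔
      ∃ l, l < (tuple ω a i).1 ∧ label ρ ω ((i, l) :: a) = v := by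
  simp only [Tuple.toFinset, Finset.mem_image, Finset.mem_univ, true_and, label]
  constructor
  · rintro ⟨l, rfl⟩
    exact ⟨l, l.2, by simp⟩
  · rintro ⟨l, hl, rfl⟩
    exact ⟨⟨l, hl⟩, by simp [hl]⟩

lemma mem_hypergraph {S : Finset ℝ} :
    S ∈ hypergraph ρ ω m ↔ ∃ j < m, ∃ a ∈ generation ρ ω j, ∃ i ∈ edgeIndices ρ ω a,
      S = insert (label ρ ω a) (tuple ω a i).toFinset := by
  induction m with
  | zero => simp [hypergraph]
  | succ m ih =>
    simp only [hypergraph, Finset.mem_union, ih, Finset.mem_biUnion, newEdges, Finset.mem_image]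
    constructor
    · rintro (⟨j, hj, h⟩ | ⟨a, ha, i, hi, rfl⟩)
      · exact ⟨j, by omega, h⟩
      · exact ⟨m, by omega, a, ha, i, hi, rfl⟩
    · rintro ⟨j, hj, a, ha, i, hi, rfl⟩
      rcases Nat.lt_succ_iff_lt_or_eq.1 hj with hj | rfl
      · exact Or.inl ⟨j, hj, a, ha, i, hi, rfl⟩
      · exact Or.inr ⟨a, ha, i, hi, rfl⟩

lemma mem_vertices_hypergraph {v : ℝ} :
    v ∈ vertices (hypergraph ρ ω m) ρ ↔
      ∃ j ≤ m, ∃ a ∈ generation ρ ω j, label ρ ω a = v := by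
  simp only [vertices, Finset.mem_insert, Finset.mem_biUnion, id]
  constructor
  · rintro (rfl | ⟨S, hS, hv⟩)
    · exact ⟨0, by omega, [], by simp, rfl⟩
    · obtain ⟨j, hj, a, ha, i, hi, rfl⟩ := mem_hypergraph.1 hS
      rcases Finset.mem_insert.1 hv with rfl | hv
      · exact ⟨j, hj.le, a, ha, rfl⟩
      · obtain ⟨l, hl, rfl⟩ := (mem_toFinset_tuple (ρ := ρ)).1 hv
        exact ⟨j + 1, hj, (i, l) :: a, cons_mem_generation_succ.2 ⟨ha, hi, hl⟩, rfl⟩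
  · rintro ⟨j, hj, a, ha, rfl⟩
    cases j with
    | zero =>
      rw [mem_generation_zero] at ha
      subst ha
      exact Or.inl rfl
    | succ j =>
      match a with
      | [] => exact Or.inl rfl
      | (i, l) :: a =>
        rw [cons_mem_generation_succ] at ha
        exact Or.inr ⟨_, mem_hypergraph.2 ⟨j, hj, a, ha.1, i, ha.2.1, rfl⟩,
          Finset.mem_insert_of_mem (mem_toFinset_tuple.2 ⟨l, ha.2.2, rfl⟩)⟩

lemma mem_marks {v : ℝ} :
    v ∈ marks η ρ ω m ↔
      ∃ j ≤ m, ∃ a ∈ generation ρ ω j, IsMarked η ρ ω a ∧ label ρ ω a = v := by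
  simp only [marks, Finset.mem_image, Finset.mem_filter, Finset.mem_biUnion, Finset.mem_range,
    IsMarked]
  constructor
  · rintro ⟨a, ⟨⟨j, hj, ha⟩, h⟩, rfl⟩
    exact ⟨j, by omega, a, ha, h, rfl⟩
  · rintro ⟨j, hj, a, ha, h, rfl⟩
    exact ⟨a, ⟨⟨j, by omega, ha⟩, h⟩, rfl⟩

lemma label_eq_root_iff (hω : IsGeneric ρ ω) (ha : a ∈ generation ρ ω m) :
    label ρ ω a = ρ ↔ a = [] := by
  constructor
  · intro h
    exact hω.eq_of_label_eq (n := 0) ha (by simp) h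
  · rintro rfl
    rfl

end Generation

/-! ### The tree structure of the random hypergraph -/

section Tree

variable {η ρ : ℝ} {ω : Sample} {m n i l : ℕ} {a b : Addr}

open Classical in
/-- The parent map of the genealogical tree, read off on labels: a label of an address in one of
the generations `0, …, m` is sent to the label of the parent address. Other numbers are fixed, which
is irrelevant for the tree structure. -/
noncomputable def parent (ρ : ℝ) (ω : Sample) (m : ℕ) (v : ℝ) : ℝ :=
  if h : ∃ a, (∃ j ≤ m, a ∈ generation ρ ω j) ∧ label ρ ω a = v then
    label ρ ω h.choose.tail else v

lemma parent_label (hω : IsGeneric ρ ω) (hj : n ≤ m) (ha : a ∈ generation ρ ω n) :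
    parent ρ ω m (label ρ ω a) = label ρ ω a.tail := by
  have h : ∃ b, (∃ j ≤ m, b ∈ generation ρ ω j) ∧ label ρ ω b = label ρ ω a :=
    ⟨a, ⟨n, hj, ha⟩, rfl⟩
  rw [parent, dif_pos h]
  obtain ⟨⟨j, _, hb⟩, h'⟩ := h.choose_spec
  rw [hω.eq_of_label_eq hb ha h']

lemma mem_children_parent (hω : IsGeneric ρ ω) {v : ℝ} (ha : a ∈ generation ρ ω n) :
    v ∈ children (hypergraph ρ ω m) ρ (parent ρ ω m) (label ρ ω a) ↔
      n < m ∧ ∃ i ∈ edgeIndices ρ ω a, ∃ l < (tuple ω a i).1, label ρ ω ((i, l) :: a) = v := by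
  simp only [children, Finset.mem_filter, mem_vertices_hypergraph]
  constructor
  · rintro ⟨⟨j, hj, b, hb, rfl⟩, hne, hpar⟩
    rw [parent_label hω hj hb] at hpar
    rw [Ne, label_eq_root_iff hω hb] at hne
    match b, j with
    | [], _ => exact absurd rfl hne
    | (i, l) :: b, 0 => simp at hb
    | (i, l) :: b, j + 1 =>
      have hb' := cons_mem_generation_succ.1 hb
      have hba : b = a := hω.eq_of_label_eq hb'.1 ha hpar
      subst hba
      have h1 := length_of_mem_generation hb'.1
      have h2 := length_of_mem_generation ha
      exact ⟨by omega, i, hb'.2.1, l, hb'.2.2, rfl⟩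
  · rintro ⟨hlt, i, hi, l, hl, rfl⟩
    have hc : (i, l) :: a ∈ generation ρ ω (n + 1) := cons_mem_generation_succ.2 ⟨ha, hi, hl⟩
    refine ⟨⟨n + 1, hlt, _, hc, rfl⟩, ?_, ?_⟩
    · rw [Ne, label_eq_root_iff hω hc]
      simp
    · rw [parent_label hω hlt hc]
      rfl

/-- Each child of a vertex lies in the block of exactly one of its hyperedges. -/
lemma exists_finpartition_children (hω : IsGeneric ρ ω) (hn : n ≤ m) (ha : a ∈ generation ρ ω n) :
    ∃ P : Finpartition (children (hypergraph ρ ω m) ρ (parent ρ ω m) (label ρ ω a)),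
      ∀ B, B ∈ P.parts ↔ n < m ∧ ∃ i ∈ edgeIndices ρ ω a, B = (tuple ω a i).toFinset := by
  classical
  rcases hn.lt_or_eq with hlt | rfl
  · refine ⟨Finpartition.ofExistsUnique
      ((edgeIndices ρ ω a).image fun i => (tuple ω a i).toFinset) ?_ ?_ ?_, ?_⟩
    · intro B hB v hv
      obtain ⟨i, hi, rfl⟩ := Finset.mem_image.1 hB
      obtain ⟨l, hl, rfl⟩ := (mem_toFinset_tuple (ρ := ρ)).1 hv
      exact (mem_children_parent hω ha).2 ⟨hlt, i, hi, l, hl, rfl⟩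
    · intro v hv
      obtain ⟨_, i, hi, l, hl, rfl⟩ := (mem_children_parent hω ha).1 hv
      refine ⟨(tuple ω a i).toFinset, ⟨Finset.mem_image_of_mem _ hi,
        mem_toFinset_tuple.2 ⟨l, hl, rfl⟩⟩, ?_⟩
      rintro B ⟨hB, hv'⟩
      obtain ⟨i', hi', rfl⟩ := Finset.mem_image.1 hB
      obtain ⟨l', hl', h⟩ := (mem_toFinset_tuple (ρ := ρ)).1 hv'
      have := hω.eq_of_label_eq (cons_mem_generation_succ.2 ⟨ha, hi', hl'⟩)
        (cons_mem_generation_succ.2 ⟨ha, hi, hl⟩) h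
      simp only [List.cons.injEq, Prod.mk.injEq] at this
      rw [this.1.1]
    · intro h
      obtain ⟨i, hi, h⟩ := Finset.mem_image.1 h
      have h0 := hω.tuple_pos a i (lt_of_mem_edgeIndices hi)
      have : label ρ ω ((i, 0) :: a) ∈ (tuple ω a i).toFinset :=
        mem_toFinset_tuple.2 ⟨0, h0, rfl⟩
      rw [h] at this
      simp at this
    · intro B
      simp [Finpartition.ofExistsUnique, hlt, eq_comm]
  · have hemp : children (hypergraph ρ ω n) ρ (parent ρ ω n) (label ρ ω a) = ∅ := by
      refine Finset.eq_empty_of_forall_notMem fun v hv => ?_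
      exact lt_irrefl _ ((mem_children_parent hω ha).1 hv).1
    rw [hemp]
    exact ⟨Finpartition.empty _, by simp⟩

lemma isTreeStructure_parent (hω : IsGeneric ρ ω) :
    IsTreeStructure (hypergraph ρ ω m) ρ (parent ρ ω m) where
  par_mem v hv hne := by
    obtain ⟨j, hj, a, ha, rfl⟩ := mem_vertices_hypergraph.1 hv
    rw [parent_label hω hj ha]
    rw [Ne, label_eq_root_iff hω ha] at hne
    match a, j with
    | [], _ => exact absurd rfl hne
    | (i, l) :: a, 0 => simp at ha
    | (i, l) :: a, j + 1 =>
      exact mem_vertices_hypergraph.2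
        ⟨j, by omega, a, (cons_mem_generation_succ.1 ha).1, rfl⟩
  reaches_root v hv := by
    obtain ⟨j, hj, a, ha, rfl⟩ := mem_vertices_hypergraph.1 hv
    induction j generalizing a with
    | zero =>
      rw [mem_generation_zero] at ha
      subst ha
      exact ⟨0, rfl⟩
    | succ j ih =>
      match a with
      | [] => exact ⟨0, rfl⟩
      | (i, l) :: a =>
        have ha' := (cons_mem_generation_succ.1 ha).1
        obtain ⟨n, hn⟩ := ih (by omega) a ha' (mem_vertices_hypergraph.2 ⟨j, by omega, a, ha', rfl⟩)
        refine ⟨n + 1, ?_⟩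
        rw [Function.iterate_succ_apply, parent_label hω hj ha]
        exact hn
  decomposition := by
    classical
    have key : ∀ q : ℝ, ∃ P : Finpartition (children (hypergraph ρ ω m) ρ (parent ρ ω m) q),
        ∀ n ≤ m, ∀ a ∈ generation ρ ω n, label ρ ω a = q → ∀ B,
          B ∈ P.parts ↔ n < m ∧ ∃ i ∈ edgeIndices ρ ω a, B = (tuple ω a i).toFinset := by
      intro q
      by_cases h : ∃ n ≤ m, ∃ a ∈ generation ρ ω n, label ρ ω a = q
      · obtain ⟨n, hn, a, ha, rfl⟩ := h
        obtain ⟨P, hP⟩ := exists_finpartition_children hω hn ha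
        refine ⟨P, fun n' hn' a' ha' h' B => ?_⟩
        obtain rfl := hω.eq_of_label_eq ha' ha h'
        rw [hP, ← length_of_mem_generation ha, ← length_of_mem_generation ha']
      · exact ⟨⊤, fun n hn a ha hq => absurd ⟨n, hn, a, ha, hq⟩ h⟩
    choose P hP using key
    refine ⟨P, fun S => ?_⟩
    rw [mem_hypergraph]
    constructor
    · rintro ⟨j, hj, a, ha, i, hi, rfl⟩
      exact ⟨label ρ ω a, mem_vertices_hypergraph.2 ⟨j, hj.le, a, ha, rfl⟩, _,
        (hP _ j hj.le a ha rfl _).2 ⟨hj, i, hi, rfl⟩, rfl⟩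
    · rintro ⟨q, hq, B, hB, rfl⟩
      obtain ⟨j, hj, a, ha, rfl⟩ := mem_vertices_hypergraph.1 hq
      obtain ⟨hlt, i, hi, rfl⟩ := (hP _ j hj a ha rfl _).1 hB
      exact ⟨j, hlt, a, ha, i, hi, rfl⟩

/-- The induction step of `IsTreeStructure.par_label`: `par` respects the edge above the address
`(i, l) :: a` if it respects the edge above `a`. The hyperedge which the parent `label ρ ω a` shares
with its child is also a block together with its `par`-parent `q`. If `q ≠ label ρ ω a`, then
`label ρ ω a` is a `par`-child of `q`, so that by assumption `q` is the genealogical parent of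
`label ρ ω a`; but `q` lies in the hyperedge and is one of its children. -/
lemma IsTreeStructure.par_label_of_parent (hω : IsGeneric ρ ω) {par : ℝ → ℝ}
    (hpar : IsTreeStructure (hypergraph ρ ω m) ρ par) (hn : n < m)
    (ha : (i, l) :: a ∈ generation ρ ω (n + 1))
    (ih : ∀ c a', a = c :: a' → par (label ρ ω a) = label ρ ω a') :
    par (label ρ ω ((i, l) :: a)) = label ρ ω a := by
  obtain ⟨ha', hi, hl⟩ := cons_mem_generation_succ.1 ha
  obtain ⟨P, hP⟩ := hpar.decomposition
  obtain ⟨q, _, B, hB, hS⟩ := (hP _).1 (mem_hypergraph.2 ⟨n, hn, a, ha', i, hi, rfl⟩)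
  have hsub : ∀ v ∈ insert (label ρ ω a) (tuple ω a i).toFinset, v ≠ q → v ≠ ρ ∧ par v = q := by
    intro v hv hne
    rw [hS] at hv
    have := (P q).le hB ((Finset.mem_insert.1 hv).resolve_left hne)
    simp only [children, Finset.mem_filter] at this
    exact this.2
  have hne : label ρ ω ((i, l) :: a) ≠ label ρ ω a := fun h => by
    simpa using congrArg List.length (hω.eq_of_label_eq ha ha' h)
  by_cases hq : q = label ρ ω a
  · rw [← hq] at hne ⊢
    exact (hsub _ (Finset.mem_insert_of_mem (mem_toFinset_tuple.2 ⟨l, hl, rfl⟩)) hne).2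
  · exfalso
    obtain ⟨hρ, hq'⟩ := hsub _ (Finset.mem_insert_self _ _) (Ne.symm hq)
    obtain ⟨l', hl', hql⟩ : ∃ l', l' < (tuple ω a i).1 ∧ label ρ ω ((i, l') :: a) = q := by
      have : q ∈ insert (label ρ ω a) (tuple ω a i).toFinset := hS ▸ Finset.mem_insert_self _ _
      exact mem_toFinset_tuple.1 ((Finset.mem_insert.1 this).resolve_left hq)
    rw [Ne, label_eq_root_iff hω ha'] at hρ
    match a, n with
    | [], _ => exact hρ rfl
    | c :: a, 0 => simp at ha'
    | (i', l'') :: a, n + 1 =>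
      rw [ih _ _ rfl, ← hql] at hq'
      have := hω.eq_of_label_eq (cons_mem_generation_succ.1 ha').1
        (cons_mem_generation_succ.2 ⟨ha', hi, hl'⟩) hq'
      have := congrArg List.length this
      simp only [List.length_cons] at this
      omega

/-- The tree structure of the random hypergraph is unique on its vertices: every tree structure
sends a vertex to its genealogical parent. -/
lemma IsTreeStructure.par_label (hω : IsGeneric ρ ω) {par : ℝ → ℝ}
    (hpar : IsTreeStructure (hypergraph ρ ω m) ρ par) (hn : n < m)
    (ha : (i, l) :: a ∈ generation ρ ω (n + 1)) :
    par (label ρ ω ((i, l) :: a)) = label ρ ω a := by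
  induction a generalizing n i l with
  | nil => exact hpar.par_label_of_parent hω hn ha (by simp)
  | cons c a ih =>
    refine hpar.par_label_of_parent hω hn ha fun c' a' h => ?_
    obtain ⟨rfl, rfl⟩ := List.cons.inj h
    match n with
    | 0 => simp [cons_mem_generation_succ] at ha
    | n + 1 => exact ih (by omega) (cons_mem_generation_succ.1 ha).1

/-- Along the genealogical tree, the event `χ` for an arbitrary tree structure of the random
hypergraph implies the existence of a witness. -/
lemma witness_of_chiAt (hω : IsGeneric ρ ω) {par : ℝ → ℝ}
    (hpar : IsTreeStructure (hypergraph ρ ω m) ρ par) {q : ℝ}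
    (hq : ChiAt (hypergraph ρ ω m) (marks η ρ ω m) ρ par q) :
    ∀ n j a, j + n = m → a ∈ generation ρ ω j → label ρ ω a = q → Witness η ρ ω n a := by
  induction hq with
  | mark hq =>
    rintro n j a hm ha rfl
    obtain ⟨j', hj', b, hb, hmark, h⟩ := mem_marks.1 hq
    obtain rfl := hω.eq_of_label_eq hb ha h
    cases n with
    | zero => exact hmark
    | succ n => exact Or.inl hmark
  | @edge q S hS hqS hchild hrec ih =>
    rintro n j a hm ha rfl
    obtain ⟨j', hj', b, hb, i, hi, rfl⟩ := mem_hypergraph.1 hS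
    have hmem : ∀ l < (tuple ω b i).1, label ρ ω ((i, l) :: b) ∈
        insert (label ρ ω b) (tuple ω b i).toFinset := fun l hl =>
      Finset.mem_insert_of_mem (mem_toFinset_tuple.2 ⟨l, hl, rfl⟩)
    have hba : a = b := by
      -- Otherwise `a` is a child of `b` in the genealogical tree, and the other way round for `par`.
      by_contra hne
      obtain ⟨l, hl, h⟩ : ∃ l, l < (tuple ω b i).1 ∧ label ρ ω ((i, l) :: b) = label ρ ω a := by
        rcases Finset.mem_insert.1 hqS with h | h
        · exact absurd (hω.eq_of_label_eq ha hb h) hne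
        · exact mem_toFinset_tuple.1 h
      have hcb := cons_mem_generation_succ.2 ⟨hb, hi, hl⟩
      have hac := hω.eq_of_label_eq hcb ha h
      have hb_child := hchild (label ρ ω b) (Finset.mem_insert_self _ _)
        fun h => hne (hω.eq_of_label_eq ha hb h.symm)
      simp only [children, Finset.mem_filter] at hb_child
      obtain ⟨_, hbρ, hbpar⟩ := hb_child
      rw [Ne, label_eq_root_iff hω hb] at hbρ
      match b, j' with
      | [], _ => exact hbρ rfl
      | c :: b, 0 => simp at hb
      | (i', l') :: b, j' + 1 =>
        rw [hpar.par_label hω (by omega) hb] at hbpar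
        have := hω.eq_of_label_eq (cons_mem_generation_succ.1 hb).1 ha hbpar
        rw [← this] at hac
        have := congrArg List.length hac
        simp only [List.length_cons] at this
        omega
    subst hba
    have hjj := (length_of_mem_generation ha).symm.trans (length_of_mem_generation hb)
    match n with
    | 0 => omega
    | n + 1 =>
      refine Or.inr ⟨i, hi, fun l hl => ?_⟩
      have hc := cons_mem_generation_succ.2 ⟨ha, hi, hl⟩
      refine ih _ (hmem l hl) (fun h => ?_) n (j + 1) _ (by omega) hc rfl
      simpa using congrArg List.length (hω.eq_of_label_eq hc ha h)

lemma chiAt_of_witness (hω : IsGeneric ρ ω) (hm : n + l = m) (ha : a ∈ generation ρ ω n)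
    (h : Witness η ρ ω l a) :
    ChiAt (hypergraph ρ ω m) (marks η ρ ω m) ρ (parent ρ ω m) (label ρ ω a) := by
  induction l generalizing n a with
  | zero => exact ChiAt.mark (mem_marks.2 ⟨n, by omega, a, ha, h, rfl⟩)
  | succ l ih =>
    rcases h with h | ⟨i, hi, h⟩
    · exact ChiAt.mark (mem_marks.2 ⟨n, by omega, a, ha, h, rfl⟩)
    · have key : ∀ v ∈ insert (label ρ ω a) (tuple ω a i).toFinset, v ≠ label ρ ω a →
          ∃ l' < (tuple ω a i).1, label ρ ω ((i, l') :: a) = v := by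
        intro v hv hne
        exact mem_toFinset_tuple.1 ((Finset.mem_insert.1 hv).resolve_left hne)
      refine ChiAt.edge (mem_hypergraph.2 ⟨n, by omega, a, ha, i, hi, rfl⟩)
        (Finset.mem_insert_self _ _) (fun v hv hne => ?_) (fun v hv hne => ?_)
      · obtain ⟨l', hl', rfl⟩ := key v hv hne
        exact (mem_children_parent hω ha).2 ⟨by omega, i, hi, l', hl', rfl⟩
      · obtain ⟨l', hl', rfl⟩ := key v hv hne
        exact ih (by omega) (cons_mem_generation_succ.2 ⟨ha, hi, hl'⟩) (h l' hl')

/-- For a generic sample the event `χ` is the recursion along the genealogical tree. -/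
lemma chi_iff_witness (hω : IsGeneric ρ ω) :
    Chi (hypergraph ρ ω m) (marks η ρ ω m) ρ ↔ Witness η ρ ω m [] := by
  constructor
  · rintro ⟨par, hpar, h⟩
    exact witness_of_chiAt hω hpar h m 0 [] (by omega) (by simp) rfl
  · intro h
    exact ⟨parent ρ ω m, isTreeStructure_parent hω,
      chiAt_of_witness (n := 0) hω (by omega) (by simp) h⟩

end Tree

/-! ### Measurability of the recursion -/

lemma measurable_sigma_iff {ι Y : Type*} {X : ι → Type*} [∀ j, MeasurableSpace (X j)]
    [MeasurableSpace Y] {f : Sigma X → Y} :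
    Measurable f ↔ ∀ j, Measurable fun x : X j => f ⟨j, x⟩ := by
  simp only [Measurable, MeasurableSpace.measurableSet_iInf, MeasurableSpace.map_def,
    Set.preimage_preimage]
  exact ⟨fun h j s hs => h hs j, fun h s hs j => h j hs⟩

lemma measurableSet_sigma_iff {ι : Type*} {X : ι → Type*} [∀ j, MeasurableSpace (X j)]
    {s : Set (Sigma X)} : MeasurableSet s ↔ ∀ j, MeasurableSet {x : X j | ⟨j, x⟩ ∈ s} := by
  simp only [MeasurableSpace.measurableSet_iInf, MeasurableSpace.map_def]
  rfl

/-- The `l`-th entry of a tuple, with value `0` if there is none. -/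
noncomputable def Tuple.entry (l : ℕ) (S : Tuple) : ℝ :=
  if h : l < S.1 then S.2 ⟨l, h⟩ else 0

lemma Tuple.entry_fin (S : Tuple) (l : Fin S.1) : S.entry l = S.2 l := by
  simp [Tuple.entry]

lemma measurable_tuple_length : Measurable (fun S : Tuple => S.1) :=
  measurable_sigma_iff.2 fun _ => measurable_const

lemma Tuple.measurable_entry (l : ℕ) : Measurable (Tuple.entry l) := by
  refine measurable_sigma_iff.2 fun j => ?_
  by_cases h : l < j
  · simpa [Tuple.entry, h] using measurable_pi_apply (⟨l, h⟩ : Fin j)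
  · simp [Tuple.entry, h]

lemma measurable_tuple (a : Addr) (i : ℕ) : Measurable fun ω : Sample => tuple ω a i := by
  unfold tuple
  fun_prop

lemma label_cons (ρ : ℝ) (ω : Sample) (i l : ℕ) (a : Addr) :
    label ρ ω ((i, l) :: a) = (tuple ω a i).entry l := rfl

lemma measurable_label (a : Addr) : Measurable fun p : ℝ × Sample => label p.1 p.2 a := by
  match a with
  | [] => exact measurable_fst
  | (i, l) :: a =>
    simp only [label_cons]
    exact (Tuple.measurable_entry l).comp ((measurable_tuple a i).comp measurable_snd)

lemma mem_edgeIndices {ρ : ℝ} {ω : Sample} {a : Addr} {i : ℕ} :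
    i ∈ edgeIndices ρ ω a ↔ i < (ω a).1.1 ∧ ((ω a).1.2 i).1 ≤ 1 / label ρ ω a := by
  simp [edgeIndices]

lemma measurableSet_isMarked (η : ℝ) (a : Addr) :
    MeasurableSet {p : ℝ × Sample | IsMarked η p.1 p.2 a} := by
  have h := measurable_label a
  unfold IsMarked
  exact measurableSet_le (by fun_prop) (by fun_prop)

lemma measurableSet_witness (η : ℝ) (n : ℕ) (a : Addr) :
    MeasurableSet {p : ℝ × Sample | Witness η p.1 p.2 n a} := by
  induction n generalizing a with
  | zero => exact measurableSet_isMarked η a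
  | succ n ih =>
    have h := measurable_label a
    have heq : {p : ℝ × Sample | Witness η p.1 p.2 (n + 1) a} =
        {p | IsMarked η p.1 p.2 a} ∪ ⋃ i, {p | i < (p.2 a).1.1} ∩
          {p | ((p.2 a).1.2 i).1 ≤ 1 / label p.1 p.2 a} ∩
            ⋂ l, ({p | l < (tuple p.2 a i).1}ᶜ ∪ {p | Witness η p.1 p.2 n ((i, l) :: a)}) := by
      ext p
      simp [Witness, mem_edgeIndices, imp_iff_not_or]
    rw [heq]
    refine (measurableSet_isMarked η a).union (MeasurableSet.iUnion fun i =>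
      MeasurableSet.inter (MeasurableSet.inter ?_ ?_)
        (MeasurableSet.iInter fun l => MeasurableSet.union (MeasurableSet.compl ?_) (ih _)))
    · exact measurableSet_lt measurable_const (by fun_prop)
    · exact measurableSet_le (by fun_prop) (by fun_prop)
    · exact measurableSet_lt measurable_const
        (measurable_tuple_length.comp ((measurable_tuple a i).comp measurable_snd))

/-! ### Subtrees -/

/-- The randomness attached to the descendants of the vertex with address `[c]`. -/
def subtree (c : ℕ × ℕ) (ω : Sample) : Sample := fun b => ω (b ++ [c])

lemma label_subtree (ρ : ℝ) (ω : Sample) (c : ℕ × ℕ) (b : Addr) :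
    label ρ ω (b ++ [c]) = label (label ρ ω [c]) (subtree c ω) b := by
  cases b <;> rfl

/-- The event at a vertex below `[c]` only depends on the label at `[c]` and on the subtree. -/
lemma witness_subtree (η ρ : ℝ) (ω : Sample) (c : ℕ × ℕ) (n : ℕ) (b : Addr) :
    Witness η ρ ω n (b ++ [c]) ↔ Witness η (label ρ ω [c]) (subtree c ω) n b := by
  induction n generalizing b with
  | zero => simp only [Witness, IsMarked, label_subtree, subtree]
  | succ n ih =>
    simp only [Witness, IsMarked, mem_edgeIndices, label_subtree, ← ih]
    rfl

lemma witness_succ_root (η ρ : ℝ) (ω : Sample) (n : ℕ) :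
    Witness η ρ ω (n + 1) [] ↔ (ω []).2 ≤ 1 - Real.exp (-(η / ρ)) ∨
      ∃ i < (ω []).1.1, ((ω []).1.2 i).1 ≤ 1 / ρ ∧ ∀ l < ((ω []).1.2 i).2.1,
        Witness η (((ω []).1.2 i).2.entry l) (subtree (i, l) ω) n [] := by
  simp only [Witness, IsMarked, mem_edgeIndices, and_assoc]
  have key (i l : ℕ) : Witness η ρ ω n [(i, l)] ↔
      Witness η (label ρ ω [(i, l)]) (subtree (i, l) ω) n [] := witness_subtree η ρ ω (i, l) n []
  simp only [key]
  rfl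

/-! ### The law of the root and of the subtrees -/

/-- The seed of the root and the samples of the subtrees are independent. -/
lemma map_prob_root_subtree (M η : ℝ) (k : ℕ) :
    (prob M η k).map (fun ω => (ω [], fun i l => subtree (i, l) ω)) =
      (seedLaw M η k).prod
        (Measure.infinitePi fun _ : ℕ => Measure.infinitePi fun _ : ℕ => prob M η k) := by
  -- The Boolean index separates the root from the other addresses; the latter are sorted by the
  -- child of the root they descend from.
  let κ : Bool → Type := fun b => cond b Unit ((ℕ × ℕ) × Addr)
  let f : (Σ b, κ b) → Addr := fun x => match x with
    | ⟨true, _⟩ => []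
    | ⟨false, p⟩ => p.2 ++ [p.1]
  have hf : Function.Injective f := by
    rintro ⟨_ | _, x⟩ ⟨_ | _, y⟩ h
    · simp only [f] at h
      obtain ⟨h1, h2⟩ := List.append_inj' h rfl
      have : x = y := Prod.ext (by simpa using h2) h1
      rw [this]
    · simp [f] at h
    · simp [f] at h
    · rfl
  have h1 : (prob M η k).map (fun ω x => ω (f x)) =
      Measure.infinitePi fun _ : (Σ b, κ b) => seedLaw M η k :=
    Measure.map_infinitePi_infinitePi_of_inj hf
  have h2 := Measure.infinitePi_map_piCurry (κ := κ) fun _ _ => seedLaw M η k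
  have h3 := Measure.infinitePi_map_eval_prod
    (P := fun b => Measure.infinitePi fun _ : κ b => seedLaw M η k) (i := true) (j := false)
    (by simp)
  have h4 : (Measure.infinitePi fun _ : κ true => seedLaw M η k).map (fun x => x ()) =
      seedLaw M η k := Measure.infinitePi_map_eval (fun _ : Unit => seedLaw M η k) ()
  have h5 : (Measure.infinitePi fun _ : κ false => seedLaw M η k).map
      (MeasurableEquiv.curry (ℕ × ℕ) Addr Seed) = Measure.infinitePi fun _ => prob M η k :=
    Measure.infinitePi_map_curry fun (_ : ℕ × ℕ) (_ : Addr) => seedLaw M η k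
  have h6 : (Measure.infinitePi fun _ : ℕ × ℕ => prob M η k).map
      (MeasurableEquiv.curry ℕ ℕ Sample) =
        Measure.infinitePi fun _ => Measure.infinitePi fun _ => prob M η k :=
    Measure.infinitePi_map_curry fun (_ : ℕ) (_ : ℕ) => prob M η k
  have h7 : (Measure.infinitePi fun _ : κ false => seedLaw M η k).map
      (MeasurableEquiv.curry ℕ ℕ Sample ∘ MeasurableEquiv.curry (ℕ × ℕ) Addr Seed) =
        Measure.infinitePi fun _ => Measure.infinitePi fun _ => prob M η k := by
    rw [← h6, ← h5, Measure.map_map (by fun_prop) (by fun_prop)]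
  have h8 := Measure.map_prod_map (Measure.infinitePi fun _ : κ true => seedLaw M η k)
    (Measure.infinitePi fun _ : κ false => seedLaw M η k) (f := fun x => x ())
    (g := MeasurableEquiv.curry ℕ ℕ Sample ∘ MeasurableEquiv.curry (ℕ × ℕ) Addr Seed)
    (by fun_prop) (by fun_prop)
  rw [h4, h7, ← h3, ← h2, ← h1, Measure.map_map (by fun_prop) (by fun_prop),
    Measure.map_map (by fun_prop) (by fun_prop), Measure.map_map (by fun_prop) (by fun_prop)] at h8
  exact h8.symm

/-! ### Void probabilities of Poisson processes -/

lemma lintegral_prod_infinitePi_range {X : Type*} [MeasurableSpace X] (μ : Measure X)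
    [IsProbabilityMeasure μ] {g : X → ENNReal} (hg : Measurable g) (n : ℕ) :
    ∫⁻ x, ∏ i ∈ Finset.range n, g (x i) ∂(Measure.infinitePi fun _ : ℕ => μ) =
      (∫⁻ x, g x ∂μ) ^ n := by
  have hind : iIndepFun (fun (i : ℕ) (x : ℕ → X) => g (x i)) (Measure.infinitePi fun _ => μ) :=
    iIndepFun_infinitePi (X := fun _ => g) fun _ => hg
  refine (lintegral_prod_eq_prod_lintegral_of_indepFun (Finset.range n) _ hind
    fun i => hg.comp (measurable_pi_apply i)).trans ?_
  simp only [fun i => (measurePreserving_eval_infinitePi (fun _ : ℕ => μ) i).lintegral_comp hg,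
    Finset.prod_const, Finset.card_range]

lemma lintegral_pow_poissonMeasure (r : NNReal) {c : ENNReal} (hc : c ≠ ⊤) :
    ∫⁻ n, c ^ n ∂(poissonMeasure r) = ENNReal.ofReal (Real.exp (-(r * (1 - c.toReal)))) := by
  have h := (NormedSpace.expSeries_div_hasSum_exp (r * c.toReal : ℝ)).mul_left (Real.exp (-r))
  rw [← Real.exp_eq_exp_ℝ, ← Real.exp_add] at h
  rw [poissonMeasure, lintegral_sum_measure]
  simp only [lintegral_smul_measure, lintegral_dirac, smul_eq_mul]
  rw [show -((r : ℝ) * (1 - c.toReal)) = -r + r * c.toReal by ring, ← h.tsum_eq,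
    ENNReal.ofReal_tsum_of_nonneg (fun n => by positivity) h.summable]
  refine tsum_congr fun n => ?_
  conv_lhs => rw [← ENNReal.ofReal_toReal hc, ← ENNReal.ofReal_pow ENNReal.toReal_nonneg,
    ← ENNReal.ofReal_mul (by positivity)]
  congr 1
  rw [mul_pow]
  ring

/-- If each point `x` of a Poisson process with finite intensity `μ` is deleted independently with
probability `g x`, no point is deleted with probability `exp (-∫ g dμ)`. -/
lemma lintegral_poissonProcess_prod {X : Type*} [MeasurableSpace X] [Inhabited X] (μ : Measure X)
    [IsFiniteMeasure μ] {g : X → ENNReal} (hg : Measurable g) (hg1 : ∀ x, g x ≤ 1) :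
    ∫⁻ y, ∏ i ∈ Finset.range y.1, (1 - g (y.2 i)) ∂(poissonProcess μ) =
      ENNReal.ofReal (Real.exp (-(∫⁻ x, g x ∂μ).toReal)) := by
  have hmeas : Measurable fun y : ℕ × (ℕ → X) => ∏ i ∈ Finset.range y.1, (1 - g (y.2 i)) := by
    refine measurable_from_prod_countable_right fun n => ?_
    exact Finset.measurable_fun_prod (Finset.range n)
      fun i _ => (hg.comp (measurable_pi_apply i)).const_sub 1
  have hfin : ∫⁻ x, g x ∂(normalized μ) ≤ 1 := by
    calc ∫⁻ x, g x ∂(normalized μ) ≤ ∫⁻ _, 1 ∂(normalized μ) := lintegral_mono hg1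
      _ = 1 := by simp
  rw [poissonProcess, lintegral_prod _ hmeas.aemeasurable]
  simp only
  simp_rw [lintegral_prod_infinitePi_range (normalized μ) (hg.const_sub 1)]
  rw [lintegral_sub hg (hfin.trans_lt ENNReal.one_lt_top).ne (ae_of_all _ hg1),
    lintegral_const, measure_univ (μ := normalized μ), one_mul, lintegral_pow_poissonMeasure _ (by simp)]
  congr 3
  rw [ENNReal.toReal_sub_of_le hfin (by simp), ENNReal.toReal_one, sub_sub_cancel]
  by_cases h0 : μ Set.univ = 0
  · -- Here `normalized μ` is a point mass, but the process has no points.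
    simp [Measure.measure_univ_eq_zero.1 h0]
  · rw [normalized, if_neg (by simp [h0]), lintegral_smul_measure, smul_eq_mul,
      ENNReal.toReal_mul, ENNReal.toReal_inv, ENNReal.coe_toNNReal_eq_toReal, ← mul_assoc,
      mul_inv_cancel₀, one_mul]
    exact ENNReal.toReal_ne_zero.2 ⟨h0, measure_ne_top _ _⟩

/-! ### Integrals over the space of tuples -/

lemma measurable_fin_prod {f : ℝ → ENNReal} (hf : Measurable f) (j : ℕ) :
    Measurable fun r : Fin j → ℝ => ∏ i, f (r i) :=
  Finset.measurable_fun_prod Finset.univ fun i _ => hf.comp (measurable_pi_apply i)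

lemma lintegral_fin_prod (f : ℝ → ENNReal) (hf : Measurable f) (j : ℕ) :
    ∫⁻ r : Fin j → ℝ, ∏ i, f (r i) = (∫⁻ x, f x) ^ j := by
  induction j with
  | zero => simp [volume_pi]
  | succ j ih =>
    have h := (volume_preserving_piFinSuccAbove (fun _ : Fin (j + 1) => ℝ) 0).symm
    rw [← h.lintegral_comp (measurable_fin_prod hf _)]
    simp only [Fin.prod_univ_succ, pow_succ', ← ih]
    rw [← lintegral_prod_mul hf.aemeasurable (measurable_fin_prod hf j).aemeasurable]
    rfl

lemma volume_apply_eq_apply {j : ℕ} {a b : Fin j} (hab : a ≠ b) :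
    volume {r : Fin j → ℝ | r a = r b} = 0 := by
  let L : (Fin j → ℝ) →ₗ[ℝ] ℝ := LinearMap.proj (R := ℝ) (φ := fun _ => ℝ) a - LinearMap.proj b
  have h : {r : Fin j → ℝ | r a = r b} = (LinearMap.ker L : Set (Fin j → ℝ)) := by
    ext r
    simp [L, sub_eq_zero]
  rw [h]
  refine Measure.addHaar_submodule _ _ fun htop => ?_
  have : Pi.single a 1 ∈ LinearMap.ker L := htop ▸ Submodule.mem_top
  simp [L, hab.symm] at this

lemma measurableSet_strictMono (j : ℕ) : MeasurableSet {r : Fin j → ℝ | StrictMono r} := by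
  simp only [StrictMono, Set.ofPred_forall]
  refine MeasurableSet.iInter fun a => MeasurableSet.iInter fun b => MeasurableSet.iInter fun _ => ?_
  exact measurableSet_lt (by fun_prop) (by fun_prop)

/-- Almost every tuple has distinct entries, and exactly one of its `j!` rearrangements is
increasing. -/
lemma factorial_mul_lintegral_strictMono (f : ℝ → ENNReal) (hf : Measurable f) (j : ℕ) :
    (j.factorial : ENNReal) * ∫⁻ r : Fin j → ℝ in {r | StrictMono r}, ∏ i, f (r i) =
      (∫⁻ x, f x) ^ j := by
  let A : Equiv.Perm (Fin j) → Set (Fin j → ℝ) := fun σ => {r | StrictMono (r ∘ σ)}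
  have hmp : ∀ σ : Equiv.Perm (Fin j), MeasurePreserving (fun r : Fin j → ℝ => r ∘ σ) := by
    intro σ
    exact (volume_measurePreserving_piCongrLeft (fun _ : Fin j => ℝ) σ).symm
  have hA : ∀ σ, MeasurableSet (A σ) := fun σ =>
    (hmp σ).measurable (measurableSet_strictMono j)
  have hdisj : Pairwise (Function.onFun Disjoint A) := by
    intro σ τ hne
    refine Set.disjoint_left.2 fun r hσ hτ => hne ?_
    have h := Tuple.unique_monotone (StrictMono.monotone hσ) (StrictMono.monotone hτ)
    have hinj : Function.Injective r := by
      have := (StrictMono.injective hσ)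
      intro x y hxy
      have := @this (σ.symm x) (σ.symm y) (by simpa using hxy)
      simpa using this
    ext x
    exact congrArg Fin.val (hinj (congrFun h x))
  have hcov : ∀ᵐ r : Fin j → ℝ, r ∈ ⋃ σ, A σ := by
    have : ∀ᵐ r : Fin j → ℝ, ∀ a b : Fin j, a ≠ b → r a ≠ r b := by
      refine ae_all_iff.2 fun a => ae_all_iff.2 fun b => ?_
      by_cases hab : a = b
      · simp [hab]
      · have := volume_apply_eq_apply hab
        filter_upwards [measure_eq_zero_iff_ae_notMem.1 this] with r hr _ using hr
    filter_upwards [this] with r hr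
    refine Set.mem_iUnion.2 ⟨Tuple.sort r, (Tuple.monotone_sort r).strictMono_of_injective ?_⟩
    intro x y hxy
    by_contra hne
    exact hr _ _ (fun h => hne ((Tuple.sort r).injective h)) hxy
  have hint : ∀ σ, ∫⁻ r in A σ, ∏ i, f (r i) = ∫⁻ r : Fin j → ℝ in {r | StrictMono r}, ∏ i, f (r i) := by
    intro σ
    rw [← (hmp σ).setLIntegral_comp_preimage (measurableSet_strictMono j)
      (measurable_fin_prod hf j)]
    refine lintegral_congr fun r => ?_
    exact (Equiv.prod_comp σ fun i => f (r i)).symm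
  have hcov' : (⋃ σ, A σ) =ᵐ[volume] Set.univ := Filter.eventuallyEq_univ.2 hcov
  rw [← lintegral_fin_prod f hf j, ← setLIntegral_univ (μ := (volume : Measure (Fin j → ℝ))),
    ← Measure.restrict_congr_set hcov', lintegral_iUnion hA hdisj]
  simp [hint, Fintype.card_perm]

lemma measurableSet_sector (M : ℝ) (j : ℕ) : MeasurableSet (sector M j) := by
  have : sector M j = {r | StrictMono r} ∩ Set.univ.pi fun _ => Set.Icc 1 M := by
    ext r
    simp only [sector, Set.mem_ofPred_eq, Set.mem_inter_iff, Set.mem_univ_pi]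
  rw [this]
  exact (measurableSet_strictMono j).inter (MeasurableSet.univ_pi fun _ => measurableSet_Icc)

lemma factorial_mul_lintegral_sector (M : ℝ) (f : ℝ → ENNReal) (hf : Measurable f) (j : ℕ) :
    (j.factorial : ENNReal) * ∫⁻ r in sector M j, ∏ i, f (r i) =
      (∫⁻ x in Set.Icc 1 M, f x) ^ j := by
  rw [← lintegral_indicator measurableSet_Icc, ← factorial_mul_lintegral_strictMono _
    (hf.indicator measurableSet_Icc), ← lintegral_indicator (measurableSet_sector M j),
    ← lintegral_indicator (measurableSet_strictMono j)]
  congr 2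
  ext r
  by_cases h : StrictMono r
  · by_cases h' : ∀ i, r i ∈ Set.Icc 1 M
    · rw [Set.indicator_of_mem (show r ∈ sector M j from ⟨h, h'⟩),
        Set.indicator_of_mem (show r ∈ {r | StrictMono r} from h)]
      exact Finset.prod_congr rfl fun i _ => (Set.indicator_of_mem (h' i) f).symm
    · rw [Set.indicator_of_notMem (fun hr : r ∈ sector M j => h' hr.2),
        Set.indicator_of_mem (show r ∈ {r | StrictMono r} from h)]
      push Not at h'
      obtain ⟨i, hi⟩ := h'
      exact (Finset.prod_eq_zero (Finset.mem_univ i) (Set.indicator_of_notMem hi f)).symm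
  · rw [Set.indicator_of_notMem (fun hr : r ∈ sector M j => h hr.1),
      Set.indicator_of_notMem (fun hr : r ∈ {r | StrictMono r} => h hr)]

lemma measurable_tuple_prod {q : ℝ → ENNReal} (hq : Measurable q) :
    Measurable fun S : Tuple => ∏ l, q (S.2 l) :=
  measurable_sigma_iff.2 fun j => measurable_fin_prod hq j

lemma measurable_sigmaMk (j : ℕ) : Measurable (fun r : Fin j → ℝ => (⟨j, r⟩ : Tuple)) :=
  measurable_sigma_iff.1 measurable_id j

/-- Integrating a multiplicative functional of finite sets against `μ_n` gives a truncated
exponential series. -/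
lemma lintegral_mu_prod (M : ℝ) (n : ℕ) {q : ℝ → ENNReal} (hq : Measurable q) :
    ∫⁻ S, ∏ l, q (S.2 l) ∂(mu M n) = ∑ j ∈ Finset.Icc 1 n,
      (∫⁻ x in Set.Icc 1 M, ENNReal.ofReal x⁻¹ * q x) ^ j / (j.factorial : ENNReal) := by
  rw [mu, lintegral_finsetSum_measure]
  refine Finset.sum_congr rfl fun j _ => ?_
  rw [lintegral_map (measurable_tuple_prod hq) (measurable_sigmaMk j)]
  dsimp only
  rw [lintegral_withDensity_eq_lintegral_mul _ (by fun_prop) (measurable_fin_prod hq j),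
    ENNReal.eq_div_iff (by positivity) (by simp), ← factorial_mul_lintegral_sector M _
    (by fun_prop)]
  congr 1
  refine setLIntegral_congr_fun (measurableSet_sector M j) fun r hr => ?_
  simp only [Pi.mul_apply, Finset.prod_mul_distrib]
  rw [ENNReal.ofReal_prod_of_nonneg fun i _ => inv_nonneg.2 (zero_le_one.trans (hr.2 i).1)]

instance isFiniteMeasure_mu (M : ℝ) (n : ℕ) : IsFiniteMeasure (mu M n) where
  measure_univ_lt_top := by
    have h := lintegral_mu_prod M n (q := fun _ => 1) measurable_const
    simp only [Finset.prod_const_one, lintegral_const, one_mul, mul_one] at h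
    rw [h]
    refine ENNReal.sum_lt_top.2 fun j _ => ENNReal.div_lt_top (ENNReal.pow_ne_top ?_) (by positivity)
    refine ne_top_of_le_ne_top (b := volume (Set.Icc 1 M)) (by simp) ?_
    rw [← setLIntegral_one]
    refine setLIntegral_mono measurable_const fun x hx => ?_
    exact ENNReal.ofReal_le_one.2 (inv_le_one_of_one_le₀ hx.1)

/-! ### The functions `A_M` and `γ_{m,M,k}` -/

/-- The substitution `t = 1 / x` in the definition of `A_M`. -/
lemma A_eq_integral {M : ℝ} (hM : 1 < M) (z : ℝ) :
    A M z = ∫ x in (1)..M, x⁻¹ * (1 - Real.exp (-(z / x))) := by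
  have hpos : ∀ x ∈ Set.uIcc 1 M, (0 : ℝ) < x := fun x hx => by
    rw [Set.uIcc_of_le hM.le] at hx
    exact zero_lt_one.trans_le hx.1
  have h := intervalIntegral.integral_comp_mul_deriv' (a := 1) (b := M) (f := fun x => x⁻¹)
    (f' := fun x => -(x ^ 2)⁻¹) (g := fun t => (1 - Real.exp (-(z * t))) / t)
    (fun x hx => hasDerivAt_inv (hpos x hx).ne') ?_ ?_
  · rw [A, one_div, intervalIntegral.integral_symm]
    simp only [inv_one] at h
    rw [← h, ← intervalIntegral.integral_neg]
    refine intervalIntegral.integral_congr fun x hx => ?_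
    have := (hpos x hx).ne'
    simp only [Function.comp_apply]
    field_simp
  · refine ContinuousOn.neg (ContinuousOn.inv₀ (by fun_prop) fun x hx => ?_)
    exact (pow_pos (hpos x hx) 2).ne'
  · rintro _ ⟨x, hx, rfl⟩
    refine ContinuousAt.continuousWithinAt ?_
    have : (fun x : ℝ => x⁻¹) x ≠ 0 := inv_ne_zero (hpos x hx).ne'
    fun_prop (disch := assumption)

lemma one_sub_exp_nonneg {z x : ℝ} (hz : 0 ≤ z) (hx : 0 ≤ x) : 0 ≤ 1 - Real.exp (-(z / x)) := by
  rw [sub_nonneg, Real.exp_le_one_iff, neg_nonpos]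
  positivity

lemma A_nonneg {M z : ℝ} (hM : 1 < M) (hz : 0 ≤ z) : 0 ≤ A M z := by
  rw [A_eq_integral hM]
  refine intervalIntegral.integral_nonneg hM.le fun x hx => ?_
  have hx0 : 0 ≤ x := zero_le_one.trans hx.1
  exact mul_nonneg (inv_nonneg.2 hx0) (one_sub_exp_nonneg hz hx0)

lemma gamma_nonneg {M η : ℝ} (hM : 1 < M) (hη : 0 ≤ η) (k m : ℕ) : 0 ≤ gamma M k m η := by
  induction m with
  | zero => exact hη
  | succ m ih =>
    refine mul_nonneg hη (Finset.sum_nonneg fun j _ => ?_)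
    have := A_nonneg hM ih
    positivity

lemma lintegral_eq_A {M z : ℝ} (hM : 1 < M) (hz : 0 ≤ z) :
    ∫⁻ x in Set.Icc 1 M, ENNReal.ofReal x⁻¹ * ENNReal.ofReal (1 - Real.exp (-(z / x))) =
      ENNReal.ofReal (A M z) := by
  have hcont : ContinuousOn (fun x : ℝ => x⁻¹ * (1 - Real.exp (-(z / x)))) (Set.Icc 1 M) := by
    have : ∀ x ∈ Set.Icc 1 M, x ≠ 0 := fun x hx => (zero_lt_one.trans_le hx.1).ne'
    fun_prop (disch := assumption)
  rw [A_eq_integral hM, intervalIntegral.integral_of_le hM.le, ← integral_Icc_eq_integral_Ioc,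
    ofReal_integral_eq_lintegral_ofReal (hcont.integrableOn_Icc)]
  · refine setLIntegral_congr_fun measurableSet_Icc fun x hx => ?_
    rw [ENNReal.ofReal_mul (inv_nonneg.2 (zero_le_one.trans hx.1))]
  · refine (ae_restrict_iff' measurableSet_Icc).2 (ae_of_all _ fun x hx => ?_)
    have hx0 : 0 ≤ x := zero_le_one.trans hx.1
    exact mul_nonneg (inv_nonneg.2 hx0) (one_sub_exp_nonneg hz hx0)

/-! ### The recursion for the witness probabilities -/

/-- The intensity of the Poisson process attached to one vertex. -/
noncomputable def seedIntensity (M η : ℝ) (k : ℕ) : Measure (ℝ × Tuple) :=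
  ENNReal.ofReal η • (uniform01.prod (mu M (k - 1)))

instance isFiniteMeasure_seedIntensity (M η : ℝ) (k : ℕ) : IsFiniteMeasure (seedIntensity M η k) :=
  Measure.smul_finite _ ENNReal.ofReal_ne_top

/-- The probability that the root with label `τ` has a witness in its first `n` generations. -/
noncomputable def witnessProb (M η : ℝ) (k n : ℕ) (τ : ℝ) : ENNReal :=
  prob M η k {ω | Witness η τ ω n []}

lemma measurable_witnessProb (M η : ℝ) (k n : ℕ) : Measurable (witnessProb M η k n) :=
  measurable_measure_prodMk_left (measurableSet_witness η n [])

lemma measurableSet_witness_fixed (η τ : ℝ) (n : ℕ) :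
    MeasurableSet {ω : Sample | Witness η τ ω n []} :=
  measurable_prodMk_left (measurableSet_witness η n [])

/-- Conditionally on a point `x = (t, S)` of the Poisson process at the root with label `τ`, the
probability that `S` spans a hyperedge of the root all of whose other vertices have a witness in
`n` further generations. -/
noncomputable def edgeProb (M η : ℝ) (k n : ℕ) (τ : ℝ) (x : ℝ × Tuple) : ENNReal :=
  (Set.Iic (1 / τ)).indicator 1 x.1 * ∏ l, witnessProb M η k n (x.2.2 l)

lemma measurable_edgeProb (M η : ℝ) (k n : ℕ) (τ : ℝ) : Measurable (edgeProb M η k n τ) := by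
  refine Measurable.mul ?_ ?_
  · exact (measurable_one.indicator measurableSet_Iic).comp measurable_fst
  · exact (measurable_tuple_prod (measurable_witnessProb M η k n)).comp measurable_snd

lemma edgeProb_le_one (M η : ℝ) (k n : ℕ) (τ : ℝ) (x : ℝ × Tuple) : edgeProb M η k n τ x ≤ 1 := by
  refine mul_le_one' ?_ (Finset.prod_le_one' fun l _ => prob_le_one)
  exact Set.indicator_le_self' (fun _ _ => bot_le) _

/-- The complement of the event in `edgeProb`, with `v l` the sample of the subtree below the `l`-th
entry of the tuple. -/
lemma infinitePi_not_edge (M η : ℝ) (k n : ℕ) (τ : ℝ) (x : ℝ × Tuple) :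
    (Measure.infinitePi fun _ : ℕ => prob M η k)
      {v | ¬ (x.1 ≤ 1 / τ ∧ ∀ l < x.2.1, Witness η (x.2.entry l) (v l) n [])} =
        1 - edgeProb M η k n τ x := by
  by_cases h : x.1 ≤ 1 / τ
  · have hset : {v : ℕ → Sample | ¬ (x.1 ≤ 1 / τ ∧
        ∀ l < x.2.1, Witness η (x.2.entry l) (v l) n [])} =
        ((Finset.range x.2.1 : Set ℕ).pi fun l => {ω | Witness η (x.2.entry l) ω n []})ᶜ := by
      ext v
      simp [show x.1 ≤ τ⁻¹ by simpa using h, Set.mem_pi]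
    have hm : ∀ l, MeasurableSet {ω : Sample | Witness η (x.2.entry l) ω n []} :=
      fun l => measurableSet_witness_fixed _ _ _
    rw [hset, prob_compl_eq_one_sub (MeasurableSet.pi (Finset.countable_toSet _) fun l _ => hm l),
      Measure.infinitePi_pi _ fun l _ => hm l, edgeProb, Set.indicator_of_mem (by simpa using h),
      Finset.prod_range]
    simp [witnessProb, Tuple.entry_fin]
  · have h' : x.1 ∉ Set.Iic (1 / τ) := h
    rw [edgeProb, Set.indicator_of_notMem h']
    simp [show ¬ x.1 ≤ τ⁻¹ by simpa using h]

/-- The branching property at the root: it has no witness if it is not marked and none of the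
points of its Poisson process spans a hyperedge all of whose other vertices have a witness. -/
lemma prob_not_witness_succ (M η : ℝ) (k n : ℕ) (τ : ℝ) :
    prob M η k {ω | ¬ Witness η τ ω (n + 1) []} =
      uniform01 (Set.Ioi (1 - Real.exp (-(η / τ)))) *
        ∫⁻ y, ∏ i ∈ Finset.range y.1, (1 - edgeProb M η k n τ (y.2 i))
          ∂(poissonProcess (seedIntensity M η k)) := by
  let Ψ : Sample → Seed × (ℕ → ℕ → Sample) := fun ω => (ω [], fun i l => subtree (i, l) ω)
  have hΨ : Measurable Ψ := by
    unfold Ψ subtree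
    fun_prop
  -- The event as a set of pairs of a seed of the root and a family of samples for the subtrees.
  let B : Set (Seed × (ℕ → ℕ → Sample)) := {p | 1 - Real.exp (-(η / τ)) < p.1.2} ∩
    ⋂ i, ({p | i < p.1.1.1}ᶜ ∪ ({p | (p.1.1.2 i).1 ≤ 1 / τ} ∩
      ⋂ l, ({p | l < (p.1.1.2 i).2.1}ᶜ ∪
        {p | Witness η ((p.1.1.2 i).2.entry l) (p.2 i l) n []}))ᶜ)
  have hB : MeasurableSet B := by
    refine MeasurableSet.inter (measurableSet_lt (by fun_prop) (by fun_prop))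
      (MeasurableSet.iInter fun i => MeasurableSet.union (MeasurableSet.compl ?_)
        (MeasurableSet.compl (MeasurableSet.inter ?_ (MeasurableSet.iInter fun l =>
          MeasurableSet.union (MeasurableSet.compl ?_) ?_))))
    · exact measurableSet_lt measurable_const (by fun_prop)
    · exact measurableSet_le (by fun_prop) measurable_const
    · exact measurableSet_lt measurable_const (measurable_tuple_length.comp (by fun_prop))
    · have : Measurable fun p : Seed × (ℕ → ℕ → Sample) =>
          (((p.1.1.2 i).2.entry l, p.2 i l) : ℝ × Sample) :=
        ((Tuple.measurable_entry l).comp (by fun_prop)).prodMk (by fun_prop)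
      exact this (measurableSet_witness η n [])
  have hpre : {ω | ¬ Witness η τ ω (n + 1) []} = Ψ ⁻¹' B := by
    ext ω
    simp [witness_succ_root, B, Ψ, imp_iff_not_or]
  have hsec : ∀ s : Seed, (Measure.infinitePi fun _ : ℕ => Measure.infinitePi fun _ : ℕ =>
      prob M η k) (Prod.mk s ⁻¹' B) =
        (∏ i ∈ Finset.range s.1.1, (1 - edgeProb M η k n τ (s.1.2 i))) *
          (Set.Ioi (1 - Real.exp (-(η / τ)))).indicator 1 s.2 := by
    intro s
    by_cases hs : 1 - Real.exp (-(η / τ)) < s.2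
    · have hset : Prod.mk s ⁻¹' B = (Finset.range s.1.1 : Set ℕ).pi fun i =>
          {v | ¬ ((s.1.2 i).1 ≤ 1 / τ ∧
            ∀ l < (s.1.2 i).2.1, Witness η ((s.1.2 i).2.entry l) (v l) n [])} := by
        ext w
        simp [B, hs, Set.mem_pi, imp_iff_not_or]
      have hm : ∀ i, MeasurableSet {v : ℕ → Sample | ¬ ((s.1.2 i).1 ≤ 1 / τ ∧
          ∀ l < (s.1.2 i).2.1, Witness η ((s.1.2 i).2.entry l) (v l) n [])} := by
        intro i
        have : {v : ℕ → Sample | ¬ ((s.1.2 i).1 ≤ 1 / τ ∧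
            ∀ l < (s.1.2 i).2.1, Witness η ((s.1.2 i).2.entry l) (v l) n [])} =
            ({v | (s.1.2 i).1 ≤ 1 / τ} ∩ ⋂ l, ({v | l < (s.1.2 i).2.1}ᶜ ∪
              {v | Witness η ((s.1.2 i).2.entry l) (v l) n []}))ᶜ := by
          ext v
          simp [imp_iff_not_or]
        rw [this]
        refine (MeasurableSet.inter (MeasurableSet.const _) (MeasurableSet.iInter fun l =>
          MeasurableSet.union (MeasurableSet.const _).compl ?_)).compl
        exact (measurableSet_witness_fixed η ((s.1.2 i).2.entry l) n).preimage (measurable_pi_apply l)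
      rw [hset, Measure.infinitePi_pi _ fun i _ => hm i, Set.indicator_of_mem
        (show s.2 ∈ Set.Ioi (1 - Real.exp (-(η / τ))) from hs)]
      simp only [infinitePi_not_edge, Pi.one_apply, mul_one]
    · have hset : Prod.mk s ⁻¹' B = ∅ := by
        ext w
        simp [B, not_lt.1 hs]
      rw [hset, Set.indicator_of_notMem
        (show s.2 ∉ Set.Ioi (1 - Real.exp (-(η / τ))) from hs)]
      simp
  have hmeas : Measurable fun y : ℕ × (ℕ → ℝ × Tuple) =>
      ∏ i ∈ Finset.range y.1, (1 - edgeProb M η k n τ (y.2 i)) :=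
    measurable_from_prod_countable_right fun N => Finset.measurable_fun_prod (Finset.range N)
      fun i _ => ((measurable_edgeProb M η k n τ).comp (measurable_pi_apply i)).const_sub 1
  rw [hpre, ← Measure.map_apply hΨ hB, map_prob_root_subtree, Measure.prod_apply hB]
  simp only [hsec]
  rw [seedLaw, ← seedIntensity, lintegral_prod_mul hmeas.aemeasurable
    (measurable_one.indicator measurableSet_Ioi).aemeasurable,
    lintegral_indicator_one measurableSet_Ioi, mul_comm]

lemma uniform01_Ioi {x : ℝ} (hx : x ∈ Set.Icc (0 : ℝ) 1) :
    uniform01 (Set.Ioi x) = ENNReal.ofReal (1 - x) := by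
  rw [uniform01, Measure.restrict_apply measurableSet_Ioi, show Set.Ioi x ∩ Set.Icc 0 1 =
    Set.Ioc x 1 from ?_, Real.volume_Ioc]
  ext y
  simp only [Set.mem_inter_iff, Set.mem_Ioi, Set.mem_Icc, Set.mem_Ioc]
  exact ⟨fun h => ⟨h.1, h.2.2⟩, fun h => ⟨h.1, hx.1.trans h.1.le, h.2⟩⟩

lemma uniform01_Iic {x : ℝ} (hx : x ∈ Set.Icc (0 : ℝ) 1) :
    uniform01 (Set.Iic x) = ENNReal.ofReal x := by
  rw [uniform01, Measure.restrict_apply measurableSet_Iic, show Set.Iic x ∩ Set.Icc 0 1 =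
    Set.Icc 0 x from ?_, Real.volume_Icc, sub_zero]
  ext y
  simp only [Set.mem_inter_iff, Set.mem_Iic, Set.mem_Icc]
  exact ⟨fun h => ⟨h.2.1, h.1⟩, fun h => ⟨h.2, h.1, h.2.trans hx.2⟩⟩

lemma uniform01_not_marked {η τ : ℝ} (hη : 0 ≤ η) (hτ : 0 ≤ τ) :
    uniform01 (Set.Ioi (1 - Real.exp (-(η / τ)))) = ENNReal.ofReal (Real.exp (-(η / τ))) := by
  rw [uniform01_Ioi ⟨one_sub_exp_nonneg hη hτ, by linarith [Real.exp_pos (-(η / τ))]⟩,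
    sub_sub_cancel]

lemma lintegral_edgeProb {M η z : ℝ} (hM : 1 < M) (hη : 0 ≤ η) (hz : 0 ≤ z) (k n : ℕ) {τ : ℝ}
    (hτ : 1 ≤ τ) (h : ∀ x ∈ Set.Icc 1 M,
      witnessProb M η k n x = ENNReal.ofReal (1 - Real.exp (-(z / x)))) :
    ∫⁻ x, edgeProb M η k n τ x ∂(seedIntensity M η k) =
      ENNReal.ofReal (η / τ * ∑ j ∈ Finset.Icc 1 (k - 1), A M z ^ j / (j.factorial : ℝ)) := by
  have hA := A_nonneg hM hz
  have hτ' : (1 / τ) ∈ Set.Icc (0 : ℝ) 1 :=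
    ⟨by positivity, by rw [one_div]; exact inv_le_one_of_one_le₀ hτ⟩
  have hint : ∫⁻ x in Set.Icc 1 M, ENNReal.ofReal x⁻¹ * witnessProb M η k n x =
      ENNReal.ofReal (A M z) := by
    rw [← lintegral_eq_A hM hz]
    exact setLIntegral_congr_fun measurableSet_Icc fun x hx => by rw [h x hx]
  have hq := measurable_witnessProb M η k n
  simp only [edgeProb]
  rw [seedIntensity, lintegral_smul_measure, lintegral_prod_mul
    (measurable_one.indicator measurableSet_Iic).aemeasurable
    (measurable_tuple_prod hq).aemeasurable, lintegral_indicator_one measurableSet_Iic,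
    uniform01_Iic hτ', lintegral_mu_prod _ _ hq, hint, smul_eq_mul, ← mul_assoc,
    ← ENNReal.ofReal_mul hη, mul_one_div, ENNReal.ofReal_mul (by positivity),
    ENNReal.ofReal_sum_of_nonneg fun j _ => by positivity]
  congr 1
  refine Finset.sum_congr rfl fun j _ => ?_
  rw [ENNReal.ofReal_div_of_pos (by positivity), ENNReal.ofReal_pow hA, ENNReal.ofReal_natCast]

lemma expTrunc_eq (k : ℕ) (hk : 1 ≤ k) (z : ℝ) :
    expTrunc k z = 1 + ∑ j ∈ Finset.Icc 1 (k - 1), z ^ j / (j.factorial : ℝ) := by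
  obtain ⟨k, rfl⟩ := Nat.exists_eq_add_of_le' hk
  rw [expTrunc, Finset.sum_range_succ', add_comm, Nat.add_sub_cancel,
    Finset.range_eq_Ico, Finset.sum_Ico_add' (fun j : ℕ => z ^ j / (j.factorial : ℝ))]
  simp
  rfl

/-- The probability that the root has no witness. -/
lemma prob_not_witness {M η : ℝ} (hM : 1 < M) (hη : 0 ≤ η) {k : ℕ} (hk : 1 ≤ k) (n : ℕ) {τ : ℝ}
    (hτ : 1 ≤ τ) :
    prob M η k {ω | ¬ Witness η τ ω n []} =
      ENNReal.ofReal (Real.exp (-(gamma M k n η / τ))) := by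
  have hτ0 : 0 ≤ τ := zero_le_one.trans hτ
  induction n generalizing τ with
  | zero =>
    have h : (prob M η k).map (fun ω => (ω []).2) = uniform01 := by
      have h1 : (prob M η k).map (fun ω => ω []) = seedLaw M η k := Measure.infinitePi_map_eval _ _
      have h2 : (seedLaw M η k).map Prod.snd = uniform01 := by
        rw [seedLaw, Measure.map_snd_prod, measure_univ, one_smul]
      rw [← h2, ← h1, Measure.map_map (by fun_prop) (by fun_prop)]
      rfl
    rw [gamma, ← uniform01_not_marked hη hτ0, ← h,
      Measure.map_apply (by fun_prop) measurableSet_Ioi]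
    congr 1
    ext ω
    simp [Witness, IsMarked, label]
  | succ n ih =>
    have hγ := gamma_nonneg hM hη k n
    have hw : ∀ x ∈ Set.Icc 1 M,
        witnessProb M η k n x = ENNReal.ofReal (1 - Real.exp (-(gamma M k n η / x))) := by
      intro x hx
      have := prob_compl_eq_one_sub (μ := prob M η k) (measurableSet_witness_fixed η x n).compl
      rw [compl_compl] at this
      rw [witnessProb, this, ENNReal.ofReal_sub _ (Real.exp_nonneg _), ENNReal.ofReal_one]
      congr 1
      exact ih hx.1 (zero_le_one.trans hx.1)
    have hA := A_nonneg hM hγ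
    rw [prob_not_witness_succ, uniform01_not_marked hη hτ0,
      lintegral_poissonProcess_prod _ (measurable_edgeProb M η k n τ) (edgeProb_le_one M η k n τ),
      lintegral_edgeProb hM hη hγ k n hτ hw, ENNReal.toReal_ofReal (by positivity),
      ← ENNReal.ofReal_mul (Real.exp_nonneg _), ← Real.exp_add, gamma, expTrunc_eq k hk]
    congr 2
    ring

/-! ### Almost every sample is generic -/

/-- The point with index `p.2` of the Poisson process at the address `p.1`. -/
def point (ω : Sample) (p : Addr × ℕ) : ℝ × Tuple := (ω p.1).1.2 p.2

lemma map_prob_point (M η : ℝ) (k : ℕ) :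
    (prob M η k).map point = Measure.infinitePi fun _ => normalized (seedIntensity M η k) := by
  have h1 : (seedLaw M η k).map (fun s => s.1.2) =
      Measure.infinitePi fun _ => normalized (seedIntensity M η k) := by
    have : (fun s : Seed => s.1.2) = Prod.snd ∘ Prod.fst := rfl
    rw [this, ← Measure.map_map (by fun_prop) (by fun_prop), seedLaw, Measure.map_fst_prod,
      measure_univ, one_smul, poissonProcess, Measure.map_snd_prod, measure_univ, one_smul,
      seedIntensity]
  have h2 := Measure.infinitePi_map_pi (fun _ : Addr => seedLaw M η k)
    (f := fun _ s => s.1.2) (fun _ => by fun_prop)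
  have h3 := Measure.infinitePi_map_curry_symm
    fun (_ : Addr) (_ : ℕ) => normalized (seedIntensity M η k)
  simp only [h1] at h2
  rw [← h2, Measure.map_map (by fun_prop) (by fun_prop)] at h3
  exact h3

lemma measurable_point : Measurable point := by
  unfold point
  fun_prop

/-- Null sets of `μ_n` can be tested on tuples of a fixed length. -/
lemma mu_eq_zero {M : ℝ} {n : ℕ} {T : Set Tuple} (hT : MeasurableSet T)
    (h : ∀ j, 1 ≤ j → volume (sector M j ∩ {r : Fin j → ℝ | ⟨j, r⟩ ∈ T}) = 0) : mu M n T = 0 := by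
  rw [mu, Measure.finsetSum_apply]
  refine Finset.sum_eq_zero fun j hj => ?_
  rw [Measure.map_apply (measurable_sigmaMk j) hT]
  refine withDensity_absolutelyContinuous _ _ ?_
  rw [Measure.restrict_apply (measurable_sigmaMk j hT), Set.inter_comm]
  exact h j (Finset.mem_Icc.1 hj).1

lemma normalized_absolutelyContinuous {X : Type*} [MeasurableSpace X] [Inhabited X] {μ : Measure X}
    [IsFiniteMeasure μ] (hμ : μ ≠ 0) : normalized μ ≪ μ := by
  rw [normalized, if_neg (by simp [hμ])]
  exact Measure.smul_absolutelyContinuous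

lemma normalized_seedIntensity_eq_zero {M η : ℝ} {k : ℕ} (h0 : seedIntensity M η k ≠ 0)
    {T : Set Tuple} (hT : mu M (k - 1) T = 0) :
    normalized (seedIntensity M η k) (Prod.snd ⁻¹' T) = 0 := by
  refine normalized_absolutelyContinuous h0 ?_
  rw [seedIntensity, Measure.smul_apply, ← Set.univ_prod, Measure.prod_prod, hT, mul_zero,
    smul_zero]

lemma ae_count_eq_zero {M η : ℝ} {k : ℕ} (h0 : seedIntensity M η k = 0) :
    ∀ᵐ ω ∂(prob M η k), ∀ a, (ω a).1.1 = 0 := by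
  refine ae_all_iff.2 fun a => ?_
  have h1 : (prob M η k).map (fun ω => ω a) = seedLaw M η k := Measure.infinitePi_map_eval _ _
  have h2 : (seedLaw M η k).map (fun s => s.1.1) = poissonMeasure 0 := by
    have : (fun s : Seed => s.1.1) = Prod.fst ∘ Prod.fst := rfl
    rw [this, ← Measure.map_map (by fun_prop) (by fun_prop), seedLaw, Measure.map_fst_prod,
      measure_univ, one_smul, poissonProcess, Measure.map_fst_prod, measure_univ, one_smul,
      ← seedIntensity, h0]
    simp
  rw [← h1, Measure.map_map (by fun_prop) (by fun_prop)] at h2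
  have h3 : ∀ᵐ n ∂(poissonMeasure 0), n = 0 := by
    rw [ae_iff, show {n : ℕ | ¬ n = 0} = {0}ᶜ from rfl,
      prob_compl_eq_zero_iff (measurableSet_singleton 0), poissonMeasure_singleton]
    simp
  rw [← h2] at h3
  exact ae_of_ae_map (show Measurable fun ω : Sample => (ω a).1.1 by fun_prop).aemeasurable h3

lemma ae_tuple_notMem {M η : ℝ} {k : ℕ} (h0 : seedIntensity M η k ≠ 0) {T : Set Tuple}
    (hT : mu M (k - 1) T = 0) (a : Addr) (i : ℕ) : ∀ᵐ ω ∂(prob M η k), tuple ω a i ∉ T := by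
  have h1 : (prob M η k).map (fun ω => point ω (a, i)) = normalized (seedIntensity M η k) := by
    rw [← Measure.infinitePi_map_eval (fun _ => normalized (seedIntensity M η k)) (a, i),
      ← map_prob_point, Measure.map_map (by fun_prop) measurable_point]
    rfl
  have h2 := measure_eq_zero_iff_ae_notMem.1 (normalized_seedIntensity_eq_zero h0 hT)
  rw [← h1] at h2
  exact ae_of_ae_map ((measurable_pi_apply (a, i)).comp measurable_point).aemeasurable h2

lemma measurableSet_entry_eq (l : ℕ) (v : ℝ) :
    MeasurableSet {S : Tuple | l < S.1 ∧ S.entry l = v} :=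
  (measurableSet_lt measurable_const measurable_tuple_length).inter
    (measurableSet_eq_fun (Tuple.measurable_entry l) measurable_const)

lemma mu_entry_eq (M : ℝ) (n l : ℕ) (v : ℝ) : mu M n {S | l < S.1 ∧ S.entry l = v} = 0 := by
  refine mu_eq_zero (measurableSet_entry_eq l v) fun j _ =>
    measure_mono_null Set.inter_subset_right ?_
  by_cases h : l < j
  · simpa [Tuple.entry, h, volume_pi] using
      Measure.pi_hyperplane (fun _ : Fin j => (volume : Measure ℝ)) ⟨l, h⟩ v
  · simp [h]

lemma mu_not_strictMono (M : ℝ) (n : ℕ) : mu M n {S | 0 < S.1 ∧ StrictMono S.2}ᶜ = 0 := by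
  refine mu_eq_zero (MeasurableSet.compl (measurableSet_sigma_iff.2 fun j =>
    (MeasurableSet.const (0 < j)).inter (measurableSet_strictMono j))) fun j hj => ?_
  have : sector M j ∩ {r : Fin j → ℝ | ⟨j, r⟩ ∈ ({S | 0 < S.1 ∧ StrictMono S.2}ᶜ : Set Tuple)} =
      ∅ := by
    exact Set.eq_empty_of_forall_notMem fun r hr => hr.2 ⟨hj, hr.1.1⟩
  rw [this, measure_empty]

/-- Entries of tuples with different indices are independent with diffuse laws. -/
lemma ae_entry_ne {M η : ℝ} {k : ℕ} (h0 : seedIntensity M η k ≠ 0) {a b : Addr} {i j : ℕ}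
    (h : (a, i) ≠ (b, j)) (l l' : ℕ) :
    ∀ᵐ ω ∂(prob M η k), l < (tuple ω a i).1 → l' < (tuple ω b j).1 →
      (tuple ω a i).entry l ≠ (tuple ω b j).entry l' := by
  have h1 : (prob M η k).map (fun ω => (point ω (a, i), point ω (b, j))) =
      (normalized (seedIntensity M η k)).prod (normalized (seedIntensity M η k)) := by
    rw [← Measure.infinitePi_map_eval_prod (P := fun _ => normalized (seedIntensity M η k)) h,
      ← map_prob_point, Measure.map_map (by fun_prop) measurable_point]
    rfl
  have hent : ∀ n, Measurable fun x : ℝ × Tuple => x.2.entry n :=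
    fun n => (Tuple.measurable_entry n).comp measurable_snd
  have hlen : Measurable fun x : ℝ × Tuple => x.2.1 := measurable_tuple_length.comp measurable_snd
  have hmeas : MeasurableSet {p : (ℝ × Tuple) × (ℝ × Tuple) |
      l' < p.2.2.1 ∧ p.2.2.entry l' = p.1.2.entry l} :=
    (measurableSet_lt measurable_const (hlen.comp measurable_snd)).inter
      (measurableSet_eq_fun ((hent l').comp measurable_snd) ((hent l).comp measurable_fst))
  have h2 : ((normalized (seedIntensity M η k)).prod (normalized (seedIntensity M η k)))
      {p | l' < p.2.2.1 ∧ p.2.2.entry l' = p.1.2.entry l} = 0 := by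
    rw [Measure.measure_prod_null hmeas]
    exact ae_of_all _ fun x => normalized_seedIntensity_eq_zero h0 (mu_entry_eq M _ l' (x.2.entry l))
  have h3 := measure_eq_zero_iff_ae_notMem.1 h2
  rw [← h1] at h3
  have h4 := ae_of_ae_map (((measurable_pi_apply (a, i)).comp measurable_point).prodMk
    ((measurable_pi_apply (b, j)).comp measurable_point)).aemeasurable h3
  filter_upwards [h4] with ω hω _ hl' heq
  exact hω ⟨hl', heq.symm⟩

lemma ae_isGeneric (M η : ℝ) (k : ℕ) (ρ : ℝ) : ∀ᵐ ω ∂(prob M η k), IsGeneric ρ ω := by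
  by_cases h0 : seedIntensity M η k = 0
  · -- This happens for `k = 1`: the law of the tuples is a point mass, but no vertex has children.
    filter_upwards [ae_count_eq_zero h0] with ω hω
    have hnil : ∀ a, IsValid ω a → a = [] := fun a ha => by
      match a with
      | [] => rfl
      | (i, l) :: a => exact absurd ha.1 (by simp [hω a])
    refine ⟨fun a i hi => absurd hi (by simp [hω a]), fun a b ha hb _ => ?_⟩
    rw [hnil a ha, hnil b hb]
  · have h1 : ∀ᵐ ω ∂(prob M η k), ∀ a i, 0 < (tuple ω a i).1 ∧ StrictMono (tuple ω a i).2 := by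
      refine ae_all_iff.2 fun a => ae_all_iff.2 fun i => ?_
      filter_upwards [ae_tuple_notMem h0 (mu_not_strictMono M _) a i] with ω hω
      exact not_not.1 hω
    have h2 : ∀ᵐ ω ∂(prob M η k), ∀ a i l, l < (tuple ω a i).1 → (tuple ω a i).entry l ≠ ρ := by
      refine ae_all_iff.2 fun a => ae_all_iff.2 fun i => ae_all_iff.2 fun l => ?_
      filter_upwards [ae_tuple_notMem h0 (mu_entry_eq M _ l ρ) a i] with ω hω hl h
      exact hω ⟨hl, h⟩
    have h3 : ∀ᵐ ω ∂(prob M η k), ∀ a i b j, (a, i) ≠ (b, j) → ∀ l l',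
        l < (tuple ω a i).1 → l' < (tuple ω b j).1 →
          (tuple ω a i).entry l ≠ (tuple ω b j).entry l' := by
      simp only [ae_all_iff]
      exact fun a i b j h l l' => by
        simpa only [ae_all_iff, Filter.eventually_imp_distrib_left] using ae_entry_ne h0 h l l'
    filter_upwards [h1, h2, h3] with ω hω1 hω2 hω3
    refine ⟨fun a i _ => (hω1 a i).1, fun a b ha hb hab => ?_⟩
    match a, b with
    | [], [] => rfl
    | [], (i, l) :: b => exact absurd hab.symm (hω2 b i l hb.2)
    | (i, l) :: a, [] => exact absurd hab (hω2 a i l ha.2)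
    | (i, l) :: a, (j, l') :: b =>
      by_cases h : (a, i) = (b, j)
      · obtain ⟨rfl, rfl⟩ := Prod.mk.inj h
        rw [label_cons, label_cons, Tuple.entry, Tuple.entry, dif_pos ha.2, dif_pos hb.2] at hab
        have := congrArg Fin.val ((hω1 a i).2.injective hab)
        rw [show l = l' from this]
      · exact absurd hab (hω3 a i b j h l l' ha.2 hb.2)

end PoissonHypergraph

open PoissonHypergraph in
theorem mainTheorem10 (M η : ℝ) (hM : 1 < M) (hη : 0 < η) (k : ℕ) (hk : 1 ≤ k) (m : ℕ)
    (ρ : ℝ) (hρ : ρ ∈ Set.Icc 1 M) :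
    NullMeasurableSet (PoissonHypergraph.chiEvent η ρ m) (PoissonHypergraph.prob M η k) ∧
      PoissonHypergraph.theta M η k m ρ =
        1 - Real.exp (-(PoissonHypergraph.gamma M k m η / ρ)) := by
  have hae : chiEvent η ρ m =ᵐ[prob M η k] {ω | Witness η ρ ω m []} := by
    filter_upwards [ae_isGeneric M η k ρ] with ω hω
    exact propext (chi_iff_witness hω)
  have hmeas := measurableSet_witness_fixed η ρ m
  refine ⟨hmeas.nullMeasurableSet.congr hae.symm, ?_⟩
  rw [theta, measureReal_congr hae, ← compl_compl {ω | Witness η ρ ω m []},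
    probReal_compl_eq_one_sub hmeas.compl, measureReal_def]
  congr 1
  exact (congrArg ENNReal.toReal (prob_not_witness hM hη.le hk m hρ.1)).trans
    (ENNReal.toReal_ofReal (Real.exp_nonneg _))
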